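/- Let $k$ be an algebraically closed field of characteristic zero, and let $n,d\ge 0$. An oriented $n$-dimensional pseudomanifold $\Delta$ on $d$ vertices is a set of oriented $(n+1)$-subsets (facets) of $\{1,\dots,d\}$, with at most one orientation for each subset, such that every $i\in\{1,\dots,d\}$ lies in a facet; every $n$-subset of $\{1,\dots,d\}$ lies in exactly zero or two facets, and in the latter case the two induced orientations cancel; and the dual graph, whose vertices are the facets and in which two distinct facets are joined by an edge if they share an $n$-subset, is nonempty and connected. We also write $\Delta$ for the simplicial complex of all subsets of facets. For $\mathcal A=\{\mathbf a_1,\dots,\mathbf a_q\}\subseteq\mathbb Z^p$ such that $\ell(\mathbf a_j)=1$ for all $j$, for some linear $\ell:\mathbb Z^p\to\mathbb Z$, let $S=k[x_1,\dots,x_q]$ with $x_j$ of multidegree $\mathbf a_j$ and standard degree $1$, and let $I_{\mathcal A}=\langle x^\alpha-x^\beta \mid \alpha,\beta\in\mathbb N^q,\ \sum\alpha_j\mathbf a_j=\sum\beta_j\mathbf a_j\rangle\subseteq S$ be the toric ideal. For $\mathbf m\in\mathbb Z^p$ let $\Delta_{\mathbf m}$ be the simplicial complex of all $s\subseteq\{1,\dots,q\}$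 such that $\mathbf m-\sum_{j\in s}\mathbf a_j$ lies in the semigroup $\mathbb N\mathcal A$ (this is the complex whose reduced homology computes $\mathrm{Tor}^S_*(I_{\mathcal A},k)_{\mathbf m}$). Let $F_0=S\leftarrow F_1\leftarrow F_2\leftarrow\cdots$ be a minimal $\mathbb Z^p$-graded free resolution of $S/I$. A minimal linear $n$-th syzygy of $I$ of multidegree $\mathbf m$ is an element $f\in F_{n+1}$, homogeneous of multidegree $\mathbf m$ and of standard degree $\ell(\mathbf m)=n+2$, with $f\notin(x_1,\dots,x_q)F_{n+1}$, that is, with nonzero class in $F_{n+1}\otimes_S k=\mathrm{Tor}_n^S(I,k)$. Its rank is the smallest dimension of a $k$-subspace $G$ of the standard degree $n+1$ component of $F_n$ such that the image of $f$ in $F_n$ lies in $S_1\cdot G$. Theorem 1.8. For every oriented $n$-dimensional pseudomanifold $\Delta$ on $d$ vertices there is a configuration $\mathcal A$ as above such that $I=I_{\mathcal A}$ is a prime ideal containing no nonzero linear form, the projective toric variety $X=V(I)\subseteq\mathbb P^{q-1}$ has dimension $d$ (that is, $S/I$ has Krull dimension $d+1$), and, for some multidegree $\mathbf m$, $I$ has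 a minimal linear $n$-th syzygy of multidegree $\mathbf m$ and rank $d$, and the geometric realization of $\Delta_{\mathbf m}$ is homotopy equivalent to that of $\Delta$. -/

import Mathlib

open MvPolynomial
open scoped ContinuousMap

/-! ### Oriented pseudomanifolds and simplicial complexes -/

/-- An oriented `n`-dimensional pseudomanifold on the `d` vertices `Fin d` (every element of
`Fin d` is a vertex), given by its oriented facets. -/
structure OrientedPseudomanifold (n d : ℕ) where
  /-- the (unoriented) facets, a set of `(n+1)`-subsets of `Fin d` -/
  facets : Finset (Finset (Fin d))
  card_facet : ∀ σ ∈ facets, σ.card = n + 1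
  /-- the orientation of a facet, relative to the orientation given by the increasing order of
  its vertices; the values outside `facets` play no role -/
  sign : Finset (Fin d) → ℤˣ
  /-- every `n`-subset lies in exactly zero or two facets -/
  zero_or_two : ∀ τ : Finset (Fin d), τ.card = n →
    (facets.filter (fun σ => τ ⊆ σ)).card = 0 ∨ (facets.filter (fun σ => τ ⊆ σ)).card = 2
  /-- the orientations induced on an `n`-subset by the facets that contain it cancel: `v ∉ τ`
  stands at position `#{u ∈ τ | u < v}` in `insert v τ` -/
  cancel : ∀ τ : Finset (Fin d), τ.card = n →
    ∑ v ∈ Finset.univ.filter (fun v => v ∉ τ ∧ insert v τ ∈ facets),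
      ((sign (insert v τ) : ℤˣ) : ℤ) * (-1) ^ (τ.filter (fun u => u < v)).card = 0
  /-- strong connectedness: the dual graph, in which two distinct facets are adjacent when they
  share an `n`-subset, is connected (in particular there is a facet) -/
  connected : (SimpleGraph.mk (V := {σ // σ ∈ facets})
    (fun σ τ => σ ≠ τ ∧ (σ.1 ∩ τ.1).card = n)
    ⟨fun _ _ h => ⟨h.1.symm, by rw [Finset.inter_comm]; exact h.2⟩⟩
    ⟨fun _ h => h.1 rfl⟩).Connected
  /-- every element of `Fin d` is a vertex -/
  exists_facet : ∀ v : Fin d, ∃ σ ∈ facets, v ∈ σ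

/-- The underlying simplicial complex: the faces are the nonempty subsets of the facets. -/
def OrientedPseudomanifold.complex {n d : ℕ} (Δ : OrientedPseudomanifold n d) :
    PreAbstractSimplicialComplex (Fin d) where
  faces := {s | s.Nonempty ∧ ∃ σ ∈ Δ.facets, s ⊆ σ}
  isRelLowerSet_faces := by
    rintro s ⟨hs, σ, hσ, hsσ⟩
    exact ⟨hs, fun t hts ht => ⟨ht, σ, hσ, hts.trans hsσ⟩⟩

/-- The geometric realization of a simplicial complex on a finite set of vertices, through
barycentric coordinates. -/
def PreAbstractSimplicialComplex.realization {V : Type*} [Fintype V]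
    (K : PreAbstractSimplicialComplex V) : Set (V → ℝ) :=
  {w | (∀ v, 0 ≤ w v) ∧ ∑ v, w v = 1 ∧ Finset.univ.filter (fun v => 0 < w v) ∈ K.faces}

/-! ### Toric ideals -/

/-- The toric ideal of the vectors `A 1, …, A q` in `ℤ^p`: it is generated by the binomials
`x^α - x^β` with `∑ α_j A_j = ∑ β_j A_j`. -/
noncomputable def toricIdeal (k : Type*) [Field k] {p q : ℕ} (A : Fin q → Fin p → ℤ) :
    Ideal (MvPolynomial (Fin q) k) :=
  Ideal.span {g | ∃ α β : Fin q →₀ ℕ, ∑ j, α j • A j = ∑ j, β j • A j ∧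
    g = monomial α 1 - monomial β 1}

/-- The simplicial complex `Δ_m` of the configuration `A` in degree `m`: the sets `s` of indices
for which `m - ∑_{j ∈ s} A j` lies in the semigroup `ℕA`. -/
def degreeComplex {p q : ℕ} (A : Fin q → Fin p → ℤ) (m : Fin p → ℤ) :
    PreAbstractSimplicialComplex (Fin q) where
  faces := {s | s.Nonempty ∧ m - ∑ j ∈ s, A j ∈ AddSubmonoid.closure (Set.range A)}
  isRelLowerSet_faces := by
    rintro s ⟨hs, hm⟩
    refine ⟨hs, fun t hts ht => ⟨ht, ?_⟩⟩
    have h : m - ∑ j ∈ t, A j = (m - ∑ j ∈ s, A j) + ∑ j ∈ s \ t, A j := by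
      rw [← Finset.sum_sdiff hts]; abel
    rw [h]
    exact add_mem hm (sum_mem fun j _ => AddSubmonoid.subset_closure ⟨j, rfl⟩)

/-! ### Minimal free resolutions and the rank of a linear syzygy -/

/-- A minimal `ℤ^p`-graded free resolution
`0 ← S/I ← F_0 = S ← F_1 ← F_2 ← ⋯`, `F_i = S^{rk i}`,
where `S` is the polynomial ring with `deg x_j = A j`. The maps are given by matrices. -/
structure MinimalFreeResolution {k : Type*} [Field k] {p q : ℕ} (A : Fin q → Fin p → ℤ)
    (I : Ideal (MvPolynomial (Fin q) k)) where
  /-- the rank of `F_i` -/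
  rk : ℕ → ℕ
  /-- the degrees of the basis elements of `F_i` -/
  mdeg : ∀ i, Fin (rk i) → Fin p → ℤ
  /-- the matrix of `F_{i+1} → F_i` -/
  diff : ∀ i, Matrix (Fin (rk i)) (Fin (rk (i + 1))) (MvPolynomial (Fin q) k)
  rk_zero : rk 0 = 1
  mdeg_zero : ∀ r, mdeg 0 r = 0
  /-- the maps preserve degrees -/
  homogeneous : ∀ i r c, IsWeightedHomogeneous A (diff i r c) (mdeg (i + 1) c - mdeg i r)
  /-- the entries of the matrices lie in the ideal generated by the variables -/
  minimal : ∀ i r c, constantCoeff (diff i r c) = 0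
  /-- the image of `F_1 → F_0 = S` is `I` -/
  mem_iff : ∀ r g, g ∈ I ↔ ∃ v, ((diff 0).mulVec v) r = g
  /-- exactness at `F_{i+1}` -/
  exact : ∀ i v, (diff i).mulVec v = 0 ↔ ∃ w, (diff (i + 1)).mulVec w = v

namespace MinimalFreeResolution

variable {k : Type*} [Field k] {p q : ℕ} {A : Fin q → Fin p → ℤ}
  {I : Ideal (MvPolynomial (Fin q) k)}

/-- The elements of `F_i` that are homogeneous of standard degree `e`, where the standard degree
of a basis element is the value of `ℓ` at its `ℤ^p`-degree. -/
noncomputable def component (F : MinimalFreeResolution A I) (ℓ : (Fin p → ℤ) →+ ℤ) (i : ℕ)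
    (e : ℤ) : Submodule k (Fin (F.rk i) → MvPolynomial (Fin q) k) :=
  Submodule.pi Set.univ fun r =>
    weightedHomogeneousSubmodule k (fun _ : Fin q => (1 : ℤ)) (e - ℓ (F.mdeg i r))

/-- `f ∈ F_{n+1}` is a minimal linear `n`-th syzygy of `I` of multidegree `m`: it is homogeneous
of degree `m`, its standard degree is `n + 2`, and it is not in the product of `F_{n+1}` with the
ideal generated by the variables, so that its class in
`F_{n+1} ⊗ k = Tor_{n+1}(S/I, k) = Tor_n(I, k)` is nonzero. -/
def IsMinimalLinearSyzygy (F : MinimalFreeResolution A I) (ℓ : (Fin p → ℤ) →+ ℤ) (n : ℕ)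
    (m : Fin p → ℤ) (f : Fin (F.rk (n + 1)) → MvPolynomial (Fin q) k) : Prop :=
  (∀ r, IsWeightedHomogeneous A (f r) (m - F.mdeg (n + 1) r)) ∧
  ℓ m = (n : ℤ) + 2 ∧
  ∃ r, constantCoeff (f r) ≠ 0

/-- The rank of a linear `n`-th syzygy `f ∈ F_{n+1}` is `s`: this is the smallest dimension of a
`k`-subspace `G` of the component of degree `n + 1` of `F_n` for which the image of `f` in `F_n`
lies in `S_1 · G`. -/
def HasSyzygyRank (F : MinimalFreeResolution A I) (ℓ : (Fin p → ℤ) →+ ℤ) (n : ℕ)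
    (f : Fin (F.rk (n + 1)) → MvPolynomial (Fin q) k) (s : ℕ) : Prop :=
  IsLeast {t : ℕ | ∃ G : Submodule k (Fin (F.rk n) → MvPolynomial (Fin q) k),
    G ≤ F.component ℓ n ((n : ℤ) + 1) ∧ Module.Finite k G ∧ Module.finrank k G = t ∧
    (F.diff n).mulVec f ∈ Submodule.span k
      {v : Fin (F.rk n) → MvPolynomial (Fin q) k | ∃ j : Fin q, ∃ g ∈ G,
        v = (X j : MvPolynomial (Fin q) k) • g}} s

end MinimalFreeResolution

/-! ### Existence of minimal free resolutions

The notions above are not vacuous: a toric ideal that is homogeneous for the standard grading has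
a minimal free resolution. -/

namespace MinimalFreeResolution

variable {k : Type*} [Field k] {p q : ℕ} {A : Fin q → Fin p → ℤ}

theorem component_mul {a m : Fin p → ℤ} {f : MvPolynomial (Fin q) k}
    (hf : IsWeightedHomogeneous A f a) (g : MvPolynomial (Fin q) k) :
    weightedHomogeneousComponent A m (f * g) = f * weightedHomogeneousComponent A (m - a) g := by
  classical
  let _ := weightedGradedAlgebra k A
  have h := DirectSum.coe_decompose_mul_add_of_left_mem (weightedHomogeneousSubmodule k A)
    (i := a) (j := m - a) (a := f) (b := g) hf
  rw [add_sub_cancel] at h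
  have hc : ∀ (φ : MvPolynomial (Fin q) k) i,
      (DirectSum.decompose (weightedHomogeneousSubmodule k A) φ i : MvPolynomial (Fin q) k) =
        weightedHomogeneousComponent A i φ :=
    fun φ i => weightedDecomposition.decompose'_apply k A φ i
  rwa [hc, hc] at h

/-- The part of degree `m` of a vector of polynomials. -/
noncomputable def vecPart {b : ℕ} (A : Fin q → Fin p → ℤ) (dg : Fin b → Fin p → ℤ)
    (m : Fin p → ℤ) (v : Fin b → MvPolynomial (Fin q) k) : Fin b → MvPolynomial (Fin q) k :=
  fun r => weightedHomogeneousComponent A (m - dg r) (v r)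

theorem mulVec_vecPart {b c : ℕ} {dg : Fin b → Fin p → ℤ} {dg' : Fin c → Fin p → ℤ}
    {D : Matrix (Fin b) (Fin c) (MvPolynomial (Fin q) k)}
    (hD : ∀ r s, IsWeightedHomogeneous A (D r s) (dg' s - dg r)) (m : Fin p → ℤ)
    (w : Fin c → MvPolynomial (Fin q) k) :
    D.mulVec (vecPart A dg' m w) = vecPart A dg m (D.mulVec w) := by
  funext r
  simp only [Matrix.mulVec, dotProduct, vecPart, map_sum]
  refine Finset.sum_congr rfl fun s _ => ?_
  rw [component_mul (hD r s)]
  congr 2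
  abel_nf

theorem sum_vecPart {b : ℕ} (dg : Fin b → Fin p → ℤ) (v : Fin b → MvPolynomial (Fin q) k) :
    ∃ U : Finset (Fin p → ℤ), v = ∑ m ∈ U, vecPart A dg m v := by
  classical
  have hfin := fun r => weightedHomogeneousComponent_finsupp (w := A) (v r)
  refine ⟨Finset.univ.biUnion fun r => (hfin r).toFinset.image (· + dg r), ?_⟩
  funext r
  rw [Finset.sum_apply]
  simp only [vecPart]
  conv_lhs => rw [← sum_weightedHomogeneousComponent (w := A) (v r)]
  rw [← finsum_comp_equiv (Equiv.subRight (dg r)), finsum_eq_sum_of_support_subset]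
  · rfl
  · intro m hm
    simp only [Finset.coe_biUnion, Set.mem_iUnion, Finset.mem_coe, Finset.mem_image]
    exact ⟨r, Finset.mem_univ _, m - dg r, (hfin r).mem_toFinset.2 hm, by simp⟩

theorem exists_minimal_step {ℓ : (Fin p → ℤ) →+ ℤ} (hℓ : ∀ j, ℓ (A j) = 1)
    {b : ℕ} (dg : Fin b → Fin p → ℤ)
    (N : Submodule (MvPolynomial (Fin q) k) (Fin b → MvPolynomial (Fin q) k))
    (hN : ∀ v ∈ N, ∀ m, vecPart A dg m v ∈ N) :
    ∃ (c : ℕ) (dg' : Fin c → Fin p → ℤ) (D : Matrix (Fin b) (Fin c) (MvPolynomial (Fin q) k)),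
      (∀ r s, IsWeightedHomogeneous A (D r s) (dg' s - dg r)) ∧
      (∀ v, v ∈ N ↔ ∃ w, D.mulVec w = v) ∧
      (∀ w, D.mulVec w = 0 → ∀ j, constantCoeff (w j) = 0) := by
  classical
  let P : ℕ → Prop := fun c => ∃ (dg' : Fin c → Fin p → ℤ)
    (D : Matrix (Fin b) (Fin c) (MvPolynomial (Fin q) k)),
      (∀ r s, IsWeightedHomogeneous A (D r s) (dg' s - dg r)) ∧
      (∀ v, v ∈ N ↔ ∃ w, D.mulVec w = v)
  have hP : ∃ c, P c := by
    let H : Set (Fin b → MvPolynomial (Fin q) k) :=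
      {h | h ∈ N ∧ ∃ m, ∀ r, IsWeightedHomogeneous A (h r) (m - dg r)}
    have hH : Submodule.span (MvPolynomial (Fin q) k) H = N := by
      refine le_antisymm (Submodule.span_le.2 fun h hh => hh.1) fun v hv => ?_
      obtain ⟨U, hU⟩ := sum_vecPart (A := A) dg v
      rw [hU]
      refine sum_mem fun m _ => Submodule.subset_span ⟨hN v hv m, m, fun r => ?_⟩
      exact weightedHomogeneousComponent_isWeightedHomogeneous _ _
    have hfg : (Submodule.span (MvPolynomial (Fin q) k) H).FG := IsNoetherian.noetherian _
    obtain ⟨T, hTH, hT⟩ := (Submodule.fg_span_iff_fg_span_finset_subset H).1 hfg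
    have hdeg : ∀ t : T, ∃ m, ∀ r, IsWeightedHomogeneous A (t.1 r) (m - dg r) :=
      fun t => (hTH t.2).2
    choose mm hmm using hdeg
    let e := T.equivFin.symm
    refine ⟨T.card, fun s => mm (e s), fun r s => (e s).1 r, fun r s => hmm _ r, fun v => ?_⟩
    rw [← hH, hT]
    have : (T : Set (Fin b → MvPolynomial (Fin q) k)) = Set.range fun s => (e s).1 := by
      ext x
      constructor
      · intro hx
        exact ⟨e.symm ⟨x, hx⟩, by simp⟩
      · rintro ⟨s, rfl⟩
        exact (e s).2
    rw [this, Submodule.mem_span_range_iff_exists_fun]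
    refine exists_congr fun w => ?_
    have : ∑ i, w i • (e i).1 = Matrix.mulVec (fun r s => (e s).1 r) w := by
      funext r
      simp [Matrix.mulVec, dotProduct, mul_comm]
    rw [this]
  obtain ⟨dg', D, hD, hDN⟩ := Nat.find_spec hP
  refine ⟨Nat.find hP, dg', D, hD, hDN, fun w hw j => ?_⟩
  by_contra hj
  have hmin := fun c => Nat.find_min hP (m := c)
  generalize Nat.find hP = c at *
  obtain _ | c := c
  · exact j.elim0
  refine hmin c (Nat.lt_succ_self c) ?_
  set w' := vecPart A dg' (dg' j) w with hw'
  have hDw' : D.mulVec w' = 0 := by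
    rw [hw', mulVec_vecPart hD, hw]
    funext r
    simp [vecPart]
  have hwj : w' j = C (constantCoeff (w j)) := by
    ext e
    rw [hw']
    simp only [vecPart, sub_self, coeff_weightedHomogeneousComponent, coeff_C]
    have hwt : ℓ (Finsupp.weight A e) = (e.degree : ℤ) := by
      rw [Finsupp.weight_apply, Finsupp.sum, map_sum, Finsupp.degree_apply]
      simp only [map_nsmul, hℓ]
      simp
    by_cases he : e = 0
    · subst he
      simp [constantCoeff_eq]
    · rw [if_neg, if_neg (Ne.symm he)]
      intro h0
      rw [h0, map_zero] at hwt
      exact he ((Finsupp.degree_eq_zero_iff e).1 (by exact_mod_cast hwt.symm))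
  refine ⟨fun s => dg' (j.succAbove s), D.submatrix id j.succAbove, fun r s => hD _ _, fun v => ?_⟩
  have key : ∀ u : Fin (c + 1) → MvPolynomial (Fin q) k, u j = 0 →
      (D.submatrix id j.succAbove).mulVec (fun s => u (j.succAbove s)) = D.mulVec u := by
    intro u hu
    funext r
    simp [Matrix.mulVec, dotProduct, Fin.sum_univ_succAbove _ j, hu]
  rw [hDN]
  constructor
  · rintro ⟨u, rfl⟩
    let u' := u - (u j * C (constantCoeff (w j))⁻¹) • w'
    refine ⟨fun s => u' (j.succAbove s), ?_⟩
    rw [key u']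
    · simp [u', Matrix.mulVec_sub, Matrix.mulVec_smul, hDw']
    · simp only [u', Pi.sub_apply, Pi.smul_apply, hwj, smul_eq_mul, mul_assoc, ← C_mul]
      rw [inv_mul_cancel₀ hj]
      simp
  · rintro ⟨u, rfl⟩
    refine ⟨j.insertNth 0 u, ?_⟩
    rw [← key _ (by simp)]
    simp

/-- A multigraded submodule of a free module which lies in the product with the ideal generated
by the variables. -/
structure GradedSub (k : Type*) [Field k] {p q : ℕ} (A : Fin q → Fin p → ℤ) where
  b : ℕ
  dg : Fin b → Fin p → ℤ
  N : Submodule (MvPolynomial (Fin q) k) (Fin b → MvPolynomial (Fin q) k)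
  graded : ∀ v ∈ N, ∀ m, vecPart A dg m v ∈ N
  minimal : ∀ v ∈ N, ∀ r, constantCoeff (v r) = 0

theorem nonempty_of_graded {ℓ : (Fin p → ℤ) →+ ℤ} (hℓ : ∀ j, ℓ (A j) = 1)
    (I : Ideal (MvPolynomial (Fin q) k))
    (hI : ∀ g ∈ I, ∀ m, weightedHomogeneousComponent A m g ∈ I)
    (hI0 : ∀ g ∈ I, constantCoeff g = 0) :
    Nonempty (MinimalFreeResolution A I) := by
  have hstep := fun s : GradedSub k A => exists_minimal_step hℓ s.dg s.N s.graded
  choose c dg' D hD hDN hDm using hstep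
  let next : GradedSub k A → GradedSub k A := fun s =>
    { b := c s
      dg := dg' s
      N := LinearMap.ker (Matrix.mulVecLin (D s))
      graded := fun v hv m => by
        have hv : (D s).mulVec v = 0 := hv
        change (D s).mulVec _ = 0
        rw [mulVec_vecPart (hD s), hv]
        funext r
        simp [vecPart]
      minimal := fun v hv => hDm s v hv }
  let s0 : GradedSub k A :=
    { b := 1
      dg := 0
      N := Submodule.pi Set.univ fun _ => I
      graded := fun v hv m r _ => by
        simpa [vecPart] using hI _ (hv r trivial) _
      minimal := fun v hv r => hI0 _ (hv r trivial) }
  let st : ℕ → GradedSub k A := fun i => Nat.rec s0 (fun _ s => next s) i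
  exact ⟨
    { rk := fun i => (st i).b
      mdeg := fun i => (st i).dg
      diff := fun i => D (st i)
      rk_zero := rfl
      mdeg_zero := fun r => rfl
      homogeneous := fun i r s => hD (st i) r s
      minimal := fun i r s => by
        have : (fun r => D (st i) r s) ∈ (st i).N := by
          rw [hDN]
          exact ⟨Pi.single s 1, by funext r; simp⟩
        exact (st i).minimal _ this r
      mem_iff := fun r g => by
        have h := fun v => hDN (st 0) v
        change Fin 1 at r
        have hr : r = 0 := Subsingleton.elim _ _
        constructor
        · intro hg
          obtain ⟨w, hw⟩ := (h (fun _ => g)).1 (fun _ _ => hg)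
          exact ⟨w, congrFun hw r⟩
        · rintro ⟨w, rfl⟩
          exact (h _).2 ⟨w, rfl⟩ r trivial
      exact := fun i v => hDN (st (i + 1)) v }⟩

/-- The toric ideal of a configuration that lies on the hyperplane `ℓ = 1` has a minimal free
resolution. -/
theorem nonempty_toricIdeal {ℓ : (Fin p → ℤ) →+ ℤ} (hℓ : ∀ j, ℓ (A j) = 1) :
    Nonempty (MinimalFreeResolution A (toricIdeal k A)) := by
  classical
  refine nonempty_of_graded hℓ _ (fun g hg => ?_) fun g hg => ?_
  · refine Submodule.span_induction ?_ ?_ ?_ ?_ hg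
    · rintro _ ⟨α, β, hαβ, rfl⟩ m
      have hw : IsWeightedHomogeneous A (monomial α (1 : k) - monomial β 1)
          (∑ j, α j • A j) := by
        refine (isWeightedHomogeneous_monomial A α 1 ?_).sub
          (isWeightedHomogeneous_monomial A β 1 ?_)
        · simp [Finsupp.weight_apply, Finsupp.sum_fintype]
        · rw [hαβ]
          simp [Finsupp.weight_apply, Finsupp.sum_fintype]
      rw [← mul_one (monomial α (1 : k) - monomial β 1), component_mul hw]
      exact Ideal.mul_mem_right _ _ (Ideal.subset_span ⟨α, β, hαβ, rfl⟩)
    · simp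
    · intro x y _ _ hx hy m
      rw [map_add]
      exact add_mem (hx m) (hy m)
    · intro a x _ hx m
      obtain ⟨U, hU⟩ := sum_vecPart (A := A) (fun _ : Fin 1 => 0) (fun _ => a)
      have hU : a = ∑ i ∈ U, weightedHomogeneousComponent A i a := by
        simpa [vecPart] using congrFun hU 0
      rw [hU, smul_eq_mul, Finset.sum_mul, map_sum]
      refine sum_mem fun i _ => ?_
      rw [component_mul (weightedHomogeneousComponent_isWeightedHomogeneous i a)]
      exact Ideal.mul_mem_left _ _ (hx _)
  · have : toricIdeal k A ≤ RingHom.ker (constantCoeff : MvPolynomial (Fin q) k →+* k) := by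
      refine Ideal.span_le.2 ?_
      rintro _ ⟨α, β, hαβ, rfl⟩
      have h : ∑ j, (α j : ℤ) = ∑ j, (β j : ℤ) := by
        have h := congrArg ℓ hαβ
        rw [map_sum, map_sum] at h
        simpa only [map_nsmul, hℓ, Int.nsmul_eq_mul, mul_one] using h
      have h0 : α = 0 ↔ β = 0 := by
        have h : ∑ j, α j = ∑ j, β j := by exact_mod_cast h
        rw [← Finsupp.degree_eq_zero_iff α, ← Finsupp.degree_eq_zero_iff β,
          Finsupp.degree_eq_sum, Finsupp.degree_eq_sum, h]
      simp [constantCoeff_monomial, h0]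
    exact this hg

end MinimalFreeResolution

/-! ### The toric ideal as a kernel -/

section Toric

variable {k : Type*} [Field k] {p q : ℕ}

/-! Take a variable `x_v` of degree `e_v` for each vertex and a variable `y_σ` of degree `e_0 - ∑_{v
∈ σ} e_v` for each facet, and put `m = e_0`. All products `y_σ ∏_{v ∈ σ} x_v` have degree `m`. The
vertex variables and one facet variable form a transcendence basis of the toric ring, which gives
the dimension. The maximal faces of `Δ_m` are the facets `σ`, each enlarged by its own new point
`y_σ`; moving the weight of `y_σ` to the barycenter of `σ` retracts `Δ_m` onto `Δ`
(`nonempty_homotopyEquiv`).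

For the syzygy, start with the elements `± y_σ` of `F_0`, signed by the orientation. The simplicial
boundary with coefficients `± x_v` sends them into the ideal, exactly because induced orientations
cancel (`boundary_signedVar_mem`). Since this boundary squares to zero, exactness lifts it step by
step to families `g τ ∈ F_i` indexed by the sets `τ` with `n + 1 - i` elements
(`IsFaceFamily.exists_succ`). As the ideal has no linear forms, generators of `F_i` have degree at
least `i + 1` for `i ≥ 1`, so there `g τ` is a constant vector. The terms `± x_v g (insert v τ)`
therefore cannot cancel one another, and `g τ` stays nonzero for every face `τ`. At `τ = ∅` this
yields the syzygy, whose image in `F_n` is `∑ x_v g {v}`.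

The `d` vectors `g {v}` bound the rank from above. For `n > 0`, taking the coefficient of `x_v`
shows that each `g {v}` lies in any admissible `G`, and their distinct multidegrees make them
independent. For `n = 0` there are at most two vertices, and rank below two would factor a nonzero
element of the prime ideal into two linear forms. -/

theorem prod_single_one {ι M : Type*} [AddCommMonoid M] (s : Finset ι) (f : ι → M) :
    ∏ j ∈ s, AddMonoidAlgebra.single (f j) (1 : k) = AddMonoidAlgebra.single (∑ j ∈ s, f j) 1 := by
  classical
  induction s using Finset.induction_on with
  | empty => simp [AddMonoidAlgebra.one_def]
  | insert a s ha ih =>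
    rw [Finset.prod_insert ha, Finset.sum_insert ha, ih, AddMonoidAlgebra.single_mul_single,
      one_mul]

/-- The homomorphism from the polynomial ring to the group ring of `ℤ^p` which sends the `j`-th
variable to the `j`-th vector of the configuration. -/
noncomputable def toricMap (k : Type*) [Field k] {p q : ℕ} (A : Fin q → Fin p → ℤ) :
    MvPolynomial (Fin q) k →ₐ[k] AddMonoidAlgebra k (Fin p → ℤ) :=
  aeval fun j => AddMonoidAlgebra.single (A j) 1

theorem toricMap_monomial (A : Fin q → Fin p → ℤ) (α : Fin q →₀ ℕ) (c : k) :
    toricMap k A (monomial α c) = AddMonoidAlgebra.single (∑ j, α j • A j) c := by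
  rw [toricMap, aeval_monomial, Finsupp.prod_fintype _ _ (by simp)]
  simp only [AddMonoidAlgebra.single_pow, one_pow]
  rw [prod_single_one, ← Algebra.smul_def, AddMonoidAlgebra.smul_single, smul_eq_mul, mul_one]

theorem toricMap_X (A : Fin q → Fin p → ℤ) (j : Fin q) :
    toricMap k A (X j) = AddMonoidAlgebra.single (A j) 1 :=
  aeval_X _ _

/-- Modulo the binomials every monomial can be replaced by a chosen one of the same degree, so a
polynomial is congruent to an expression depending only on its image in the group ring. -/
theorem toricIdeal_eq_ker (A : Fin q → Fin p → ℤ) :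
    toricIdeal k A = RingHom.ker (toricMap k A) := by
  classical
  refine le_antisymm (Ideal.span_le.2 ?_) fun g hg => ?_
  · rintro _ ⟨α, β, h, rfl⟩
    change toricMap k A _ = 0
    rw [map_sub, toricMap_monomial, toricMap_monomial, h, sub_self]
  -- A chosen exponent for each degree; the value `0` at degrees outside the semigroup is never
  -- used.
  · let s : (Fin p → ℤ) → Fin q →₀ ℕ := fun a =>
      if h : ∃ α : Fin q →₀ ℕ, ∑ j, α j • A j = a then h.choose else 0
    have hs : ∀ α : Fin q →₀ ℕ, ∑ j, s (∑ j, α j • A j) j • A j = ∑ j, α j • A j := by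
      intro α
      have h : ∃ β : Fin q →₀ ℕ, ∑ j, β j • A j = ∑ j, α j • A j := ⟨α, rfl⟩
      simp only [s, dif_pos h]
      exact h.choose_spec
    let ψ : AddMonoidAlgebra k (Fin p → ℤ) →ₗ[k] MvPolynomial (Fin q) k :=
      (Finsupp.lsum k fun a => monomial (s a)).comp (AddMonoidAlgebra.coeffLinearEquiv k).toLinearMap
    have hψ : ∀ a c, ψ (AddMonoidAlgebra.single a c) = monomial (s a) c := fun a c => by
      simp [ψ]
    have key : ∀ g : MvPolynomial (Fin q) k, g - ψ (toricMap k A g) ∈ toricIdeal k A := by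
      intro g
      induction g using MvPolynomial.induction_on' with
      | monomial α c =>
        have h : monomial α c - monomial (s (∑ j, α j • A j)) c =
            C c * (monomial α (1 : k) - monomial (s (∑ j, α j • A j)) 1) := by
          simp [mul_sub, C_mul_monomial]
        rw [toricMap_monomial, hψ, h]
        exact Ideal.mul_mem_left _ _ (Ideal.subset_span ⟨α, _, (hs α).symm, rfl⟩)
      | add g h hg hh =>
        rw [map_add, map_add, add_sub_add_comm]
        exact add_mem hg hh
    have h := key g
    have hg : toricMap k A g = 0 := hg
    rwa [hg, map_zero, sub_zero] at h

/-- The group ring of `ℤ^p` over a field is a domain. -/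
theorem toricIdeal_isPrime (A : Fin q → Fin p → ℤ) : (toricIdeal k A).IsPrime := by
  rw [toricIdeal_eq_ker]
  exact RingHom.ker_isPrime _

theorem isWeightedHomogeneous_map {A : Fin q → Fin p → ℤ} {ℓ : (Fin p → ℤ) →+ ℤ}
    (hℓ : ∀ j, ℓ (A j) = 1) {g : MvPolynomial (Fin q) k} {a : Fin p → ℤ}
    (hg : IsWeightedHomogeneous A g a) :
    IsWeightedHomogeneous (fun _ : Fin q => (1 : ℤ)) g (ℓ a) := by
  intro e he
  rw [← hg he, Finsupp.weight_apply, Finsupp.weight_apply, Finsupp.sum, Finsupp.sum, map_sum]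
  simp only [map_nsmul, hℓ]

/-- Distinct variables go to distinct basis elements of the group ring, hence to independent ones.
-/
theorem eq_zero_of_mem_toricIdeal_of_isHomogeneous_one {A : Fin q → Fin p → ℤ}
    (hA : Function.Injective A) {g : MvPolynomial (Fin q) k} (hg : g ∈ toricIdeal k A)
    (h1 : g.IsHomogeneous 1) : g = 0 := by
  classical
  have hsum : g = ∑ j, monomial (Finsupp.single j 1) (coeff (Finsupp.single j 1) g) := by
    ext e
    rw [coeff_sum]
    simp only [coeff_monomial]
    by_cases he : ∃ i, Finsupp.single i 1 = e
    · obtain ⟨i, rfl⟩ := he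
      rw [Finset.sum_eq_single i]
      · simp
      · intro j _ hj
        rw [if_neg]
        simpa [Finsupp.single_left_inj] using hj
      · simp
    · rw [Finset.sum_eq_zero fun j _ => if_neg fun h => he ⟨j, h⟩]
      by_contra h0
      have hd : e.degree = 1 := by
        have h2 : Finsupp.weight (fun _ => 1) e = 1 := h1 h0
        rwa [← Finsupp.degree_eq_weight_one] at h2
      have : e ∈ Set.range fun i : Fin q => Finsupp.single i 1 := by
        rw [Finsupp.range_single_one]
        exact hd
      exact he this
  have hg' : ∑ j, AddMonoidAlgebra.single (A j) (coeff (Finsupp.single j 1) g) = 0 := by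
    have hg : toricMap k A g = 0 := by rwa [toricIdeal_eq_ker, RingHom.mem_ker] at hg
    rw [hsum, map_sum] at hg
    rw [← hg]
    refine Finset.sum_congr rfl fun j _ => ?_
    rw [toricMap_monomial, Finset.sum_eq_single j] <;> simp +contextual
  rw [hsum]
  refine Finset.sum_eq_zero fun j _ => ?_
  have h := congrArg (fun x => x.coeff (A j)) hg'
  simp only [AddMonoidAlgebra.coeff_sum, Finsupp.finsetSum_apply, AddMonoidAlgebra.coeff_single] at h
  rw [Finset.sum_eq_single j] at h
  · simpa using h
  · intro i _ hi
    rw [Finsupp.single_apply, if_neg fun h => hi (hA h)]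
  · simp

end Toric

/-! ### Krull dimension of finitely generated domains -/

/-- Incomparability gives `≤`; lying over and going up lift chains of primes and give `≥`. -/
theorem ringKrullDim_eq_of_isIntegral_of_injective {R S : Type*} [CommRing R] [CommRing S]
    [Algebra R S] [Algebra.IsIntegral R S] (hinj : Function.Injective (algebraMap R S)) :
    ringKrullDim S = ringKrullDim R := by
  refine le_antisymm ?_ ?_
  · refine Order.krullDim_le_of_strictMono (PrimeSpectrum.comap (algebraMap R S)) ?_
    intro P Q h
    exact Ideal.IsIntegral.comap_lt_comap (I := P.asIdeal) (J := Q.asIdeal) h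
  · have key : ∀ l : LTSeries (PrimeSpectrum R), ∃ l' : LTSeries (PrimeSpectrum S),
        l'.length = l.length ∧ PrimeSpectrum.comap (algebraMap R S) l'.last = l.last := by
      intro l
      induction l using RelSeries.inductionOn' with
      | singleton x =>
        obtain ⟨Q, _, hQ, hQx⟩ := Ideal.exists_ideal_over_prime_of_isIntegral x.asIdeal (⊥ : Ideal S)
          (by rw [← RingHom.ker_eq_comap_bot, (RingHom.injective_iff_ker_eq_bot _).1 hinj]
              exact bot_le)
        exact ⟨RelSeries.singleton _ ⟨Q, hQ⟩, rfl, PrimeSpectrum.ext hQx⟩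
      | snoc l x h ih =>
        obtain ⟨l', hl, hl'⟩ := ih
        have hlt : l.last < x := h
        obtain ⟨Q, hle, hQ, hQx⟩ := Ideal.exists_ideal_over_prime_of_isIntegral x.asIdeal
          l'.last.asIdeal (by
            have := congrArg PrimeSpectrum.asIdeal hl'
            rw [PrimeSpectrum.comap_asIdeal] at this
            rw [this]
            exact hlt.le)
        have hlt' : l'.last < ⟨Q, hQ⟩ := by
          refine lt_of_le_of_ne hle fun h => hlt.ne ?_
          rw [← hl', h]
          exact PrimeSpectrum.ext hQx
        refine ⟨l'.snoc ⟨Q, hQ⟩ hlt', by simp [hl], ?_⟩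
        rw [RelSeries.last_snoc, RelSeries.last_snoc]
        exact PrimeSpectrum.ext hQx
    rw [ringKrullDim, Order.krullDim, iSup_le_iff]
    intro l
    obtain ⟨l', hl, -⟩ := key l
    rw [← hl]
    exact Order.LTSeries.length_le_krullDim l'

/-- By Noether normalization the dimension is the number of variables of a polynomial subring with
integral extension; those variables form another transcendence basis, of the same size. -/
theorem ringKrullDim_eq_of_isTranscendenceBasis {k R : Type*} [Field k] [CommRing R] [IsDomain R]
    [Algebra k R] [Algebra.FiniteType k R] {c : ℕ} {x : Fin c → R}
    (hx : IsTranscendenceBasis k x) : ringKrullDim R = (c : WithBot ℕ∞) := by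
  obtain ⟨s, g, hg, hint⟩ := exists_integral_inj_algHom_of_fg k R
  algebraize [g.toRingHom]
  have : Algebra.IsIntegral (MvPolynomial (Fin s) k) R := ⟨hint⟩
  have h1 := ringKrullDim_eq_of_isIntegral_of_injective (R := MvPolynomial (Fin s) k) (S := R) hg
  rw [h1, MvPolynomial.ringKrullDim_of_isNoetherianRing, ringKrullDim_eq_zero_of_field, zero_add]
  have : FaithfulSMul (MvPolynomial (Fin s) k) R := (faithfulSMul_iff_algebraMap_injective _ _).2 hg
  have : IsScalarTower k (MvPolynomial (Fin s) k) R := IsScalarTower.of_algHom g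
  have hy := (IsTranscendenceBasis.mvPolynomial (Fin s) k).algebraMap_comp (A := R)
  have hc := hx.lift_cardinalMk_eq hy
  simp only [Cardinal.mk_fin, Cardinal.lift_natCast, Nat.cast_inj] at hc
  simp [hc]

/-! ### Algebraic independence in a toric ring -/

section Toric

variable {k : Type*} [Field k] {p q : ℕ}

theorem toricMap_injective {A : Fin q → Fin p → ℤ}
    (hA : ∀ α β : Fin q →₀ ℕ, ∑ j, α j • A j = ∑ j, β j • A j → α = β) :
    Function.Injective (toricMap k A) := by
  rw [RingHom.injective_iff_ker_eq_bot]
  change RingHom.ker (toricMap k A) = ⊥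
  rw [← toricIdeal_eq_ker, toricIdeal, Ideal.span_eq_bot]
  rintro _ ⟨α, β, h, rfl⟩
  rw [hA α β h, sub_self]

/-- Independence can be tested in the group ring, where evaluation at these variables is the toric
map of the subconfiguration `A ∘ t`. -/
theorem algebraicIndependent_mk_X (A : Fin q → Fin p → ℤ) {c : ℕ} (t : Fin c → Fin q)
    (ht : ∀ α β : Fin c →₀ ℕ, ∑ j, α j • A (t j) = ∑ j, β j • A (t j) → α = β) :
    AlgebraicIndependent k fun i => Ideal.Quotient.mk (toricIdeal k A) (X (t i)) := by
  let φ : (MvPolynomial (Fin q) k ⧸ toricIdeal k A) →ₐ[k] AddMonoidAlgebra k (Fin p → ℤ) :=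
    Ideal.Quotient.liftₐ (toricIdeal k A) (toricMap k A)
      (fun a ha => by rwa [toricIdeal_eq_ker] at ha)
  refine AlgebraicIndependent.of_comp φ ?_
  have h : (φ ∘ fun i => Ideal.Quotient.mk (toricIdeal k A) (X (t i))) =
      fun i => AddMonoidAlgebra.single (A (t i)) (1 : k) := by
    funext i
    exact toricMap_X A (t i)
  rw [h]
  exact toricMap_injective ht

end Toric

theorem isAlgebraic_of_mul_eq {R S : Type*} [CommRing R] [CommRing S] [Algebra R S] {a b : R}
    (ha : a ≠ 0) {x : S} (h : algebraMap R S a * x = algebraMap R S b) : IsAlgebraic R x := by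
  refine ⟨Polynomial.C a * Polynomial.X - Polynomial.C b, fun h0 => ha ?_, by simp [h]⟩
  simpa using congrArg (fun f => Polynomial.coeff f 1) h0

namespace OrientedPseudomanifold

variable {n d : ℕ} (Δ : OrientedPseudomanifold n d)

/-! ### The configuration of a pseudomanifold -/

/-- The vector `e_0 - ∑_{v ∈ τ} e_v`. -/
def faceVec (τ : Finset (Fin d)) : Fin (d + 1) → ℤ :=
  Fin.cons 1 fun v => if v ∈ τ then -1 else 0

/-- The vector `e_v` of a vertex `v`. -/
def vertexVec (v : Fin d) : Fin (d + 1) → ℤ := Pi.single v.succ 1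

theorem faceVec_insert_add {τ : Finset (Fin d)} {v : Fin d} (hv : v ∉ τ) :
    faceVec (insert v τ) + vertexVec v = faceVec τ := by
  funext i
  refine Fin.cases ?_ (fun u => ?_) i
  · simp [faceVec, vertexVec]
  · by_cases h : u = v
    · subst h; simp [faceVec, vertexVec, hv]
    · simp [faceVec, vertexVec, h]

theorem faceVec_add_sum (τ : Finset (Fin d)) : faceVec τ + ∑ v ∈ τ, vertexVec v = faceVec ∅ := by
  induction τ using Finset.induction_on with
  | empty => simp
  | insert v τ hv ih => rw [Finset.sum_insert hv, ← add_assoc, faceVec_insert_add hv, ih]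

theorem faceVec_injective : Function.Injective (faceVec (d := d)) := by
  intro σ τ h
  ext v
  have := congrFun h v.succ
  simp only [faceVec, Fin.cons_succ] at this
  by_cases h1 : v ∈ σ <;> by_cases h2 : v ∈ τ <;> simp_all

theorem vertexVec_ne_faceVec (v : Fin d) (τ : Finset (Fin d)) : vertexVec v ≠ faceVec τ := by
  intro h
  simpa [vertexVec, faceVec] using congrFun h 0

/-- The index set of the configuration of a pseudomanifold: its vertices and its facets. -/
abbrev Index : Type := Fin d ⊕ {σ // σ ∈ Δ.facets}

/-- The number of vectors of the configuration of a pseudomanifold. -/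
abbrev numVars : ℕ := Fintype.card Δ.Index

/-- A numbering of the vertices and the facets. -/
noncomputable def indexEquiv : Fin Δ.numVars ≃ Δ.Index := (Fintype.equivFin Δ.Index).symm

/-- The configuration of a pseudomanifold: the vectors `e_v` for the vertices `v` and
`e_0 - ∑_{v ∈ σ} e_v` for the facets `σ`. -/
noncomputable def config (j : Fin Δ.numVars) : Fin (d + 1) → ℤ :=
  Sum.elim vertexVec (fun σ => faceVec σ.1) (Δ.indexEquiv j)

/-- The index of the variable of a vertex. -/
noncomputable def vertexVar (v : Fin d) : Fin Δ.numVars := Δ.indexEquiv.symm (Sum.inl v)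

/-- The index of the variable of a facet. -/
noncomputable def facetVar (σ : {σ // σ ∈ Δ.facets}) : Fin Δ.numVars :=
  Δ.indexEquiv.symm (Sum.inr σ)

@[simp] theorem config_vertexVar (v : Fin d) : Δ.config (Δ.vertexVar v) = vertexVec v := by
  simp [config, vertexVar]

@[simp] theorem config_facetVar (σ : {σ // σ ∈ Δ.facets}) :
    Δ.config (Δ.facetVar σ) = faceVec σ.1 := by
  simp [config, facetVar]

theorem vertexVar_injective : Function.Injective Δ.vertexVar :=
  Δ.indexEquiv.symm.injective.comp Sum.inl_injective

theorem facetVar_ne_vertexVar (σ : {σ // σ ∈ Δ.facets}) (v : Fin d) :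
    Δ.facetVar σ ≠ Δ.vertexVar v := by
  simp [facetVar, vertexVar]

theorem forall_var {P : Fin Δ.numVars → Prop} (hv : ∀ v, P (Δ.vertexVar v))
    (hσ : ∀ σ, P (Δ.facetVar σ)) (j : Fin Δ.numVars) : P j := by
  rw [← Δ.indexEquiv.symm_apply_apply j]
  rcases Δ.indexEquiv j with v | σ
  · exact hv v
  · exact hσ σ

theorem config_injective : Function.Injective Δ.config := by
  have h : Function.Injective (Sum.elim vertexVec fun σ : {σ // σ ∈ Δ.facets} => faceVec σ.1) := by
    refine Function.Injective.sumElim (fun u v h => ?_)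
      (faceVec_injective.comp Subtype.val_injective) fun v σ => vertexVec_ne_faceVec v σ.1
    simpa [vertexVec, Pi.single_inj, Pi.single_apply] using congrFun h u.succ
  exact h.comp Δ.indexEquiv.injective

/-- The linear form which takes the value `1` on the configuration. -/
def height (n d : ℕ) : (Fin (d + 1) → ℤ) →+ ℤ where
  toFun x := (n + 2) * x 0 + ∑ v : Fin d, x v.succ
  map_zero' := by simp
  map_add' x y := by simp only [Pi.add_apply, Finset.sum_add_distrib]; ring

/-- The weight `n + 2` of coordinate `0` gives facets, which have `n + 1` vertices, height `1`. -/
theorem height_faceVec (τ : Finset (Fin d)) : height n d (faceVec τ) = n + 2 - τ.card := by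
  simp [height, faceVec, Finset.sum_ite_mem, sub_eq_add_neg]

theorem height_vertexVec (v : Fin d) : height n d (vertexVec v) = 1 := by
  simp [height, vertexVec, Pi.single_apply]

theorem height_config (j : Fin Δ.numVars) : height n d (Δ.config j) = 1 := by
  refine Δ.forall_var (P := fun j => height n d (Δ.config j) = 1) (fun v => ?_) (fun σ => ?_) j
  · rw [config_vertexVar, height_vertexVec]
  · rw [config_facetVar, height_faceVec, Δ.card_facet _ σ.2]
    push_cast
    ring

theorem nonempty_facets : Nonempty {σ // σ ∈ Δ.facets} := Δ.connected.nonempty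

/-- The vertex variables and one `y_σ₀` form a transcendence basis: any other `y_σ` satisfies `y_σ
∏_{v ∈ σ} x_v = y_σ₀ ∏_{v ∈ σ₀} x_v`. -/
theorem ringKrullDim_config (k : Type*) [Field k] :
    ringKrullDim (MvPolynomial (Fin Δ.numVars) k ⧸ toricIdeal k Δ.config) =
      ((d + 1 : ℕ) : WithBot ℕ∞) := by
  obtain ⟨σ₀⟩ := Δ.nonempty_facets
  have hprime := toricIdeal_isPrime (k := k) Δ.config
  have := Ideal.Quotient.isDomain (toricIdeal k Δ.config)
  set mk := Ideal.Quotient.mk (toricIdeal k Δ.config) with hmk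
  let t : Fin (d + 1) → Fin Δ.numVars := Fin.cons (Δ.facetVar σ₀) Δ.vertexVar
  have hind := algebraicIndependent_mk_X (k := k) Δ.config t (by
    intro α β h
    -- Coordinate `0` reads off the exponent of `y_σ₀`; the other coordinates then determine those
    -- of the `x_v`.
    have h0 : ∀ γ : Fin (d + 1) →₀ ℕ, (∑ j, γ j • Δ.config (t j)) 0 = γ 0 := by
      intro γ
      simp [t, Fin.sum_univ_succ, faceVec, vertexVec]
    have hs : ∀ (γ : Fin (d + 1) →₀ ℕ) (v : Fin d), (∑ j, γ j • Δ.config (t j)) v.succ =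
        γ v.succ + γ 0 * (if v ∈ σ₀.1 then -1 else 0) := by
      intro γ v
      simp [t, Fin.sum_univ_succ, faceVec, vertexVec, Pi.single_apply, Finset.sum_apply, add_comm]
    have e0 : α 0 = β 0 := by
      have := congrFun h 0
      rw [h0, h0] at this
      exact_mod_cast this
    ext i
    refine Fin.cases e0 (fun v => ?_) i
    have := congrFun h v.succ
    rw [hs, hs, e0] at this
    exact_mod_cast add_right_cancel this)
  refine ringKrullDim_eq_of_isTranscendenceBasis
    (x := fun i => mk (X (t i))) (hind.isTranscendenceBasis_iff_isAlgebraic.2 ⟨fun r => ?_⟩)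
  set S := Algebra.adjoin k (Set.range fun i => mk (X (t i)))
  have hv : ∀ v, mk (X (Δ.vertexVar v)) ∈ S := fun v => Algebra.subset_adjoin ⟨v.succ, rfl⟩
  have hσ₀ : mk (X (Δ.facetVar σ₀)) ∈ S := Algebra.subset_adjoin ⟨0, rfl⟩
  have hprod : ∀ σ : {σ // σ ∈ Δ.facets}, toricMap k Δ.config
      ((∏ v ∈ σ.1, X (Δ.vertexVar v)) * X (Δ.facetVar σ)) =
        AddMonoidAlgebra.single (faceVec ∅) 1 := by
    intro σ
    rw [map_mul, map_prod]
    simp only [toricMap_X, config_vertexVar, config_facetVar]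
    rw [prod_single_one, AddMonoidAlgebra.single_mul_single, one_mul,
      add_comm (∑ v ∈ σ.1, vertexVec v), faceVec_add_sum]
  have hX : ∀ j, IsAlgebraic S (mk (X j)) := by
    refine Δ.forall_var (fun v => ?_) (fun σ => ?_)
    · exact isAlgebraic_algebraMap (⟨_, hv v⟩ : S)
    · have ha : (∏ v ∈ σ.1, ⟨_, hv v⟩ : S) ≠ 0 := by
        refine Finset.prod_ne_zero_iff.2 fun v _ h => ?_
        have h : mk (X (Δ.vertexVar v)) = 0 := congrArg Subtype.val h
        rw [hmk, Ideal.Quotient.eq_zero_iff_mem] at h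
        exact X_ne_zero _ (eq_zero_of_mem_toricIdeal_of_isHomogeneous_one Δ.config_injective h
          (isHomogeneous_X k _))
      refine isAlgebraic_of_mul_eq (b := (∏ v ∈ σ₀.1, ⟨_, hv v⟩) * ⟨_, hσ₀⟩) ha ?_
      rw [map_mul, map_prod, map_prod]
      simp only [Subalgebra.algebraMap_def, Algebra.algebraMap_self, RingHom.id_apply]
      rw [← map_prod, ← map_prod, ← map_mul, ← map_mul, Ideal.Quotient.mk_eq_mk_iff_sub_mem,
        toricIdeal_eq_ker, RingHom.mem_ker, map_sub]
      exact sub_eq_zero.2 ((hprod σ).trans (hprod σ₀).symm)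
  obtain ⟨g, rfl⟩ := Ideal.Quotient.mk_surjective r
  induction g using MvPolynomial.induction_on with
  | C a => exact isAlgebraic_algebraMap (algebraMap k S a)
  | add f g hf hg => rw [map_add]; exact hf.add hg
  | mul_X f j hf => rw [map_mul]; exact hf.mul (hX j)

end OrientedPseudomanifold

namespace OrientedPseudomanifold

variable {n d : ℕ} (Δ : OrientedPseudomanifold n d)

/-! ### The simplicial complex in the degree `e_0` -/

theorem sum_var {M : Type*} [AddCommMonoid M] (f : Fin Δ.numVars → M) :
    ∑ j, f j = ∑ v, f (Δ.vertexVar v) + ∑ σ, f (Δ.facetVar σ) := by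
  rw [← Equiv.sum_comp Δ.indexEquiv.symm f, Fintype.sum_sum_type]
  rfl

/-- Coordinate `0` counts the facet vectors in a sum equal to `e_0`, so exactly one facet `σ`
occurs, once; outside `σ` nothing can offset a vertex vector. -/
theorem mem_faces_degreeComplex {s : Finset (Fin Δ.numVars)} :
    s ∈ (degreeComplex Δ.config (faceVec ∅)).faces ↔ s.Nonempty ∧
      ∃ σ : {σ // σ ∈ Δ.facets}, (∀ v, Δ.vertexVar v ∈ s → v ∈ σ.1) ∧
        ∀ τ, Δ.facetVar τ ∈ s → τ = σ := by
  classical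
  constructor
  · rintro ⟨hs, hm⟩
    refine ⟨hs, ?_⟩
    obtain ⟨a, ha⟩ := AddSubmonoid.exists_of_mem_closure_range _ _ hm
    -- Adding the indicator of `s` turns membership into an expression of `e_0` with positive
    -- coefficients on `s`.
    let γ : Fin Δ.numVars → ℕ := fun j => a j + if j ∈ s then 1 else 0
    have hγ : faceVec ∅ = ∑ v, γ (Δ.vertexVar v) • vertexVec v +
        ∑ σ : {σ // σ ∈ Δ.facets}, γ (Δ.facetVar σ) • faceVec σ.1 := by
      have h : faceVec ∅ = ∑ j, γ j • Δ.config j := by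
        simp only [γ, add_smul, Finset.sum_add_distrib, ite_smul, one_smul, zero_smul,
          Finset.sum_ite_mem, Finset.univ_inter]
        rw [← ha, sub_add_cancel]
      simpa only [sum_var, config_vertexVar, config_facetVar] using h
    have hs1 : ∀ j ∈ s, 0 < γ j := fun j hj => by simp [γ, hj]
    have h0 : ∑ σ, γ (Δ.facetVar σ) = 1 := by
      have := congrFun hγ 0
      simp only [Pi.add_apply, Finset.sum_apply, Pi.smul_apply, vertexVec, faceVec] at this
      simp at this
      exact_mod_cast this.symm
    obtain ⟨σ, hσ⟩ : ∃ σ, γ (Δ.facetVar σ) ≠ 0 := by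
      by_contra! h
      simp [h] at h0
    have hle := h0 ▸ Finset.add_sum_erase Finset.univ (fun σ => γ (Δ.facetVar σ)) (Finset.mem_univ σ)
    have hother : ∀ τ, τ ≠ σ → γ (Δ.facetVar τ) = 0 := by
      intro τ hτ
      have := Finset.single_le_sum (f := fun σ => γ (Δ.facetVar σ)) (fun _ _ => Nat.zero_le _)
        (Finset.mem_erase.2 ⟨hτ, Finset.mem_univ τ⟩)
      omega
    refine ⟨σ, fun v hv => ?_, fun τ hτ => ?_⟩
    · by_contra hvσ
      have := congrFun hγ v.succ
      simp only [Pi.add_apply, Finset.sum_apply, Pi.smul_apply] at this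
      rw [Finset.sum_eq_single σ (fun τ _ hτ => by simp [hother τ hτ]) (by simp),
        Finset.sum_eq_single v (fun u _ hu => by simp [vertexVec, hu.symm]) (by simp)] at this
      simp [vertexVec, faceVec, hvσ] at this
      have := hs1 _ hv
      omega
    · by_contra h
      exact (hs1 _ hτ).ne' (hother τ h)
  · rintro ⟨hs, σ, hv, hτ⟩
    -- The full set of `σ` and its own variable is a face because its vectors sum to `e_0`; `s` is a
    -- subset of it.
    let T : Finset (Fin Δ.numVars) := insert (Δ.facetVar σ) (σ.1.image Δ.vertexVar)
    have hT : T ∈ (degreeComplex Δ.config (faceVec ∅)).faces := by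
      refine ⟨Finset.insert_nonempty _ _, ?_⟩
      rw [Finset.sum_insert, Finset.sum_image Δ.vertexVar_injective.injOn]
      · simp only [config_vertexVar, config_facetVar, faceVec_add_sum, sub_self]
        exact zero_mem _
      · simp only [Finset.mem_image, not_exists, not_and]
        exact fun v _ h => Δ.facetVar_ne_vertexVar σ v h.symm
    refine ((degreeComplex Δ.config (faceVec ∅)).isRelLowerSet_faces hT).2 ?_ hs
    intro j
    refine Δ.forall_var (P := fun j => j ∈ s → j ∈ T) (fun v h => ?_) (fun τ h => ?_) j
    · exact Finset.mem_insert_of_mem (Finset.mem_image_of_mem _ (hv v h))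
    · rw [hτ τ h]
      exact Finset.mem_insert_self _ _

theorem filter_pos_nonempty {V : Type*} [Fintype V] {w : V → ℝ} (h : ∑ v, w v = 1) :
    (Finset.univ.filter fun v => 0 < w v).Nonempty := by
  by_contra hne
  rw [Finset.not_nonempty_iff_eq_empty, Finset.filter_eq_empty_iff] at hne
  have : ∑ v, w v ≤ 0 := Finset.sum_nonpos fun v hv => not_lt.1 (hne hv)
  linarith

theorem mem_realization_degreeComplex {u : Fin Δ.numVars → ℝ} :
    u ∈ (degreeComplex Δ.config (faceVec ∅)).realization ↔
      (∀ j, 0 ≤ u j) ∧ ∑ j, u j = 1 ∧ ∃ σ : {σ // σ ∈ Δ.facets},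
        (∀ v, v ∉ σ.1 → u (Δ.vertexVar v) = 0) ∧ ∀ τ, τ ≠ σ → u (Δ.facetVar τ) = 0 := by
  refine and_congr_right fun h0 => and_congr_right fun h1 => ?_
  have hpos : ∀ j, 0 < u j ↔ u j ≠ 0 := fun j => (h0 j).lt_iff_ne'
  rw [mem_faces_degreeComplex, and_iff_right (filter_pos_nonempty h1)]
  simp only [Finset.mem_filter, Finset.mem_univ, true_and, hpos]
  refine exists_congr fun σ => and_congr (forall_congr' fun v => ?_) (forall_congr' fun τ => ?_)
  · exact not_imp_comm
  · exact not_imp_comm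

theorem mem_realization_complex {w : Fin d → ℝ} :
    w ∈ Δ.complex.realization ↔ (∀ v, 0 ≤ w v) ∧ ∑ v, w v = 1 ∧
      ∃ σ : {σ // σ ∈ Δ.facets}, ∀ v, v ∉ σ.1 → w v = 0 := by
  refine and_congr_right fun h0 => and_congr_right fun h1 => ?_
  have hpos : ∀ j, 0 < w j ↔ w j ≠ 0 := fun j => (h0 j).lt_iff_ne'
  change (_ ∧ _) ↔ _
  rw [and_iff_right (filter_pos_nonempty h1)]
  simp only [Finset.subset_iff, Finset.mem_filter, Finset.mem_univ, true_and, hpos, Subtype.exists,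
    exists_prop]
  exact exists_congr fun σ => and_congr_right fun _ => forall_congr' fun v => not_imp_comm

/-- Extension by zero from the vertices of the pseudomanifold to all indices. -/
noncomputable def extend (w : Fin d → ℝ) (j : Fin Δ.numVars) : ℝ :=
  Sum.elim w 0 (Δ.indexEquiv j)

@[simp] theorem extend_vertexVar (w : Fin d → ℝ) (v : Fin d) :
    Δ.extend w (Δ.vertexVar v) = w v := by
  simp [extend, vertexVar]

@[simp] theorem extend_facetVar (w : Fin d → ℝ) (σ : {σ // σ ∈ Δ.facets}) :
    Δ.extend w (Δ.facetVar σ) = 0 := by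
  simp [extend, facetVar]

theorem continuous_extend : Continuous Δ.extend := by
  refine continuous_pi fun j => ?_
  refine Δ.forall_var (P := fun j => Continuous fun w => Δ.extend w j) (fun v => ?_) (fun σ => ?_) j
  · simpa using continuous_apply v
  · simpa using continuous_const

/-- The map which moves the weight at each facet to the barycenter of the facet. -/
noncomputable def collapse (u : Fin Δ.numVars → ℝ) (v : Fin d) : ℝ :=
  u (Δ.vertexVar v) + ∑ σ : {σ // σ ∈ Δ.facets}, if v ∈ σ.1 then u (Δ.facetVar σ) / (n + 1) else 0

theorem continuous_collapse : Continuous Δ.collapse := by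
  refine continuous_pi fun v => ?_
  refine (continuous_apply _).add (continuous_finsetSum _ fun σ _ => ?_)
  split_ifs
  · exact (continuous_apply _).div_const _
  · exact continuous_const

theorem collapse_extend (w : Fin d → ℝ) : Δ.collapse (Δ.extend w) = w := by
  funext v
  simp [collapse]

theorem collapse_nonneg {u : Fin Δ.numVars → ℝ} (hu : ∀ j, 0 ≤ u j) (v : Fin d) :
    0 ≤ Δ.collapse u v := by
  refine add_nonneg (hu _) (Finset.sum_nonneg fun σ _ => ?_)
  split_ifs
  · exact div_nonneg (hu _) (by positivity)
  · exact le_rfl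

theorem sum_collapse (u : Fin Δ.numVars → ℝ) : ∑ v, Δ.collapse u v = ∑ j, u j := by
  rw [sum_var]
  simp only [collapse]
  rw [Finset.sum_add_distrib, Finset.sum_comm]
  congr 1
  refine Finset.sum_congr rfl fun σ _ => ?_
  rw [Finset.sum_ite_mem, Finset.univ_inter, Finset.sum_const, Δ.card_facet _ σ.2, nsmul_eq_mul]
  push_cast
  field_simp

/-- Only the facet `σ` carries weight, and its barycenter is supported on `σ`; thus collapsing never
leaves the simplex. -/
theorem collapse_eq_zero {u : Fin Δ.numVars → ℝ} {σ : {σ // σ ∈ Δ.facets}}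
    (h : (∀ v, v ∉ σ.1 → u (Δ.vertexVar v) = 0) ∧ ∀ τ, τ ≠ σ → u (Δ.facetVar τ) = 0)
    {v : Fin d} (hv : v ∉ σ.1) : Δ.collapse u v = 0 := by
  rw [collapse, h.1 v hv, zero_add]
  refine Finset.sum_eq_zero fun τ _ => ?_
  split_ifs with hτ
  · rw [h.2 τ (by rintro rfl; exact hv hτ), zero_div]
  · rfl

theorem sum_extend (w : Fin d → ℝ) : ∑ j, Δ.extend w j = ∑ v, w v := by
  simp [sum_var]

theorem extend_nonneg {w : Fin d → ℝ} (hw : ∀ v, 0 ≤ w v) (j : Fin Δ.numVars) :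
    0 ≤ Δ.extend w j := by
  refine Δ.forall_var (P := fun j => 0 ≤ Δ.extend w j) (fun v => ?_) (fun σ => ?_) j
  · simpa using hw v
  · simp

theorem collapse_mem {u : Fin Δ.numVars → ℝ}
    (hu : u ∈ (degreeComplex Δ.config (faceVec ∅)).realization) :
    Δ.collapse u ∈ Δ.complex.realization := by
  obtain ⟨h0, h1, σ, hσ⟩ := Δ.mem_realization_degreeComplex.1 hu
  exact Δ.mem_realization_complex.2 ⟨Δ.collapse_nonneg h0, by rw [sum_collapse, h1], σ,
    fun v => Δ.collapse_eq_zero hσ⟩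

theorem extend_mem {w : Fin d → ℝ} (hw : w ∈ Δ.complex.realization) :
    Δ.extend w ∈ (degreeComplex Δ.config (faceVec ∅)).realization := by
  obtain ⟨h0, h1, σ, hσ⟩ := Δ.mem_realization_complex.1 hw
  exact Δ.mem_realization_degreeComplex.2 ⟨Δ.extend_nonneg h0, by rw [sum_extend, h1], σ,
    fun v hv => by simpa using hσ v hv, fun τ _ => by simp⟩

/-- A point and its collapse lie in one common simplex, which is convex, so the straight-line
homotopy is available. -/
theorem segment_mem {u : Fin Δ.numVars → ℝ}
    (hu : u ∈ (degreeComplex Δ.config (faceVec ∅)).realization) {t : ℝ} (ht : t ∈ unitInterval) :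
    (1 - t) • Δ.extend (Δ.collapse u) + t • u ∈
      (degreeComplex Δ.config (faceVec ∅)).realization := by
  obtain ⟨h0, h1, σ, hσ⟩ := Δ.mem_realization_degreeComplex.1 hu
  refine Δ.mem_realization_degreeComplex.2 ⟨fun j => ?_, ?_, σ, fun v hv => ?_, fun τ hτ => ?_⟩
  · exact add_nonneg (mul_nonneg (sub_nonneg.2 ht.2) (Δ.extend_nonneg (Δ.collapse_nonneg h0) j))
      (mul_nonneg ht.1 (h0 j))
  · simp only [Pi.add_apply, Pi.smul_apply, smul_eq_mul]
    rw [Finset.sum_add_distrib, ← Finset.mul_sum, ← Finset.mul_sum, sum_extend, sum_collapse, h1]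
    ring
  · simp [hσ.1 v hv, Δ.collapse_eq_zero hσ hv]
  · simp [hσ.2 τ hτ]

theorem nonempty_homotopyEquiv :
    Nonempty ((degreeComplex Δ.config (faceVec ∅)).realization ≃ₕ Δ.complex.realization) := by
  refine ⟨{
    toFun := ⟨fun u => ⟨Δ.collapse u.1, Δ.collapse_mem u.2⟩,
      (Δ.continuous_collapse.comp continuous_subtype_val).subtype_mk _⟩
    invFun := ⟨fun w => ⟨Δ.extend w.1, Δ.extend_mem w.2⟩,
      (Δ.continuous_extend.comp continuous_subtype_val).subtype_mk _⟩
    left_inv := ⟨{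
      toFun := fun x => ⟨(1 - (x.1 : ℝ)) • Δ.extend (Δ.collapse x.2.1) + (x.1 : ℝ) • x.2.1,
        Δ.segment_mem x.2.2 x.1.2⟩
      continuous_toFun := by
        refine Continuous.subtype_mk ?_ _
        have := Δ.continuous_extend
        have := Δ.continuous_collapse
        fun_prop
      map_zero_left := fun u => Subtype.ext (by simp)
      map_one_left := fun u => Subtype.ext (by simp) }⟩
    right_inv := ?_ }⟩
  -- This composite is the identity on the nose, as collapsing undoes extension.
  convert ContinuousMap.Homotopic.refl _
  ext w : 1
  exact Subtype.ext (Δ.collapse_extend w.1).symm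

end OrientedPseudomanifold

/-! ### Degree bounds in a minimal resolution -/

section Degree

variable {k : Type*} [Field k] {q : ℕ}

theorem weight_one_eq_degree (e : Fin q →₀ ℕ) :
    Finsupp.weight (fun _ : Fin q => (1 : ℤ)) e = (e.degree : ℤ) := by
  simp [Finsupp.weight_apply, Finsupp.sum, Finsupp.degree_apply]

theorem eq_C_of_isWeightedHomogeneous_nonpos {g : MvPolynomial (Fin q) k} {a : ℤ} (ha : a ≤ 0)
    (hg : IsWeightedHomogeneous (fun _ : Fin q => (1 : ℤ)) g a) : g = C (constantCoeff g) := by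
  classical
  ext e
  rw [coeff_C]
  split_ifs with he
  · rw [← he, constantCoeff_eq]
  · by_contra h
    have := hg h
    rw [weight_one_eq_degree] at this
    have h0 : e.degree = 0 := by omega
    exact he ((Finsupp.degree_eq_zero_iff e).1 h0).symm

end Degree

namespace MinimalFreeResolution

variable {k : Type*} [Field k] {p q : ℕ} {A : Fin q → Fin p → ℤ}
  {I : Ideal (MvPolynomial (Fin q) k)} (F : MinimalFreeResolution A I)

/-- A zero column would make a basis vector a cycle, hence a boundary; by minimality boundaries have
no constant terms. -/
theorem exists_diff_ne_zero (i : ℕ) (c : Fin (F.rk (i + 1))) : ∃ r, F.diff i r c ≠ 0 := by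
  by_contra! h
  obtain ⟨w, hw⟩ := (F.exact i (Pi.single c 1)).1 (by funext r; simp [h])
  have := congrArg constantCoeff (congrFun hw c)
  simp [Matrix.mulVec, dotProduct, F.minimal] at this

theorem diff_zero_mem (r : Fin (F.rk 0)) (c : Fin (F.rk 1)) : F.diff 0 r c ∈ I :=
  (F.mem_iff r _).2 ⟨Pi.single c 1, by simp⟩

/-- Nonzero entries without constant term raise the degree by at least one at each step, and by at
least two at the first, where linear forms are excluded. -/
theorem le_degree_mdeg {ℓ : (Fin p → ℤ) →+ ℤ} (hℓ : ∀ j, ℓ (A j) = 1)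
    (hI : ∀ g ∈ I, g.IsHomogeneous 1 → g = 0) (i : ℕ) (c : Fin (F.rk (i + 1))) :
    (i : ℤ) + 2 ≤ ℓ (F.mdeg (i + 1) c) := by
  have key : ∀ (i : ℕ) (c : Fin (F.rk (i + 1))), ∃ r e, coeff e (F.diff i r c) ≠ 0 ∧
      ℓ (F.mdeg (i + 1) c) = ℓ (F.mdeg i r) + e.degree ∧ 1 ≤ e.degree := by
    intro i c
    obtain ⟨r, hr⟩ := F.exists_diff_ne_zero i c
    obtain ⟨e, he⟩ := MvPolynomial.ne_zero_iff.1 hr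
    refine ⟨r, e, he, ?_, ?_⟩
    · have := isWeightedHomogeneous_map hℓ (F.homogeneous i r c) he
      rw [weight_one_eq_degree, map_sub] at this
      omega
    · rw [Nat.one_le_iff_ne_zero, ne_eq, Finsupp.degree_eq_zero_iff]
      rintro rfl
      exact he (F.minimal i r c)
  induction i with
  | zero =>
    obtain ⟨r, e, he, hdeg, h1⟩ := key 0 c
    rw [F.mdeg_zero, map_zero] at hdeg
    rcases h1.eq_or_lt with h | h
    · exfalso
      refine he ?_
      rw [hI _ (F.diff_zero_mem r c), coeff_zero]
      intro e' he'
      have := isWeightedHomogeneous_map hℓ (F.homogeneous 0 r c) he'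
      rw [weight_one_eq_degree, map_sub, F.mdeg_zero, map_zero, hdeg] at this
      change Finsupp.weight (fun _ => 1) e' = 1
      rw [← Finsupp.degree_eq_weight_one]
      change e'.degree = 1
      omega
    · rw [hdeg]
      push_cast
      omega
  | succ i ih =>
    obtain ⟨r, e, -, hdeg, h1⟩ := key (i + 1) c
    have := ih r
    rw [hdeg]
    push_cast
    omega

end MinimalFreeResolution

namespace OrientedPseudomanifold

variable {n d : ℕ} (Δ : OrientedPseudomanifold n d) {k : Type*} [Field k]

/-! ### The linear syzygy of a pseudomanifold -/

/-- The coefficient of the face `insert v τ` in the boundary map: the variable of `v` up to sign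
for `v ∉ τ`, and zero for `v ∈ τ`. -/
noncomputable def boundaryCoeff (k : Type*) [Field k] (τ : Finset (Fin d)) (v : Fin d) :
    MvPolynomial (Fin Δ.numVars) k :=
  if v ∈ τ then 0 else (-1) ^ (τ.filter fun u => u < v).card * X (Δ.vertexVar v)

/-- The boundary of a family of vectors indexed by faces. -/
noncomputable def boundary {b : ℕ} (g : Finset (Fin d) → Fin b → MvPolynomial (Fin Δ.numVars) k)
    (τ : Finset (Fin d)) : Fin b → MvPolynomial (Fin Δ.numVars) k :=
  ∑ v, Δ.boundaryCoeff k τ v • g (insert v τ)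

theorem boundaryCoeff_mul_self (τ : Finset (Fin d)) (v : Fin d) :
    Δ.boundaryCoeff k τ v * Δ.boundaryCoeff k (insert v τ) v = 0 := by
  simp [boundaryCoeff]

/-- Inserting `u` shifts the position of `v` by one, while inserting `v` does not move `u`. -/
theorem boundaryCoeff_mul_of_lt {τ : Finset (Fin d)} {u v : Fin d} (h : u < v) :
    Δ.boundaryCoeff k τ v * Δ.boundaryCoeff k (insert v τ) u =
      -(Δ.boundaryCoeff k τ u * Δ.boundaryCoeff k (insert u τ) v) := by
  by_cases hu : u ∈ τ
  · simp [boundaryCoeff, hu]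
  by_cases hv : v ∈ τ
  · simp [boundaryCoeff, hv]
  have h1 : ((insert u τ).filter fun w => w < v).card = (τ.filter fun w => w < v).card + 1 := by
    rw [Finset.filter_insert, if_pos h, Finset.card_insert_of_notMem (by simp [hu])]
  have h2 : ((insert v τ).filter fun w => w < u) = τ.filter fun w => w < u := by
    rw [Finset.filter_insert, if_neg h.not_gt]
  simp only [boundaryCoeff, Finset.mem_insert, hu, hv, h.ne, h.ne', or_self, if_false, h1, h2,
    pow_succ]
  ring

theorem boundaryCoeff_mul (τ : Finset (Fin d)) (u v : Fin d) :
    Δ.boundaryCoeff k τ v * Δ.boundaryCoeff k (insert v τ) u =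
      -(Δ.boundaryCoeff k τ u * Δ.boundaryCoeff k (insert u τ) v) := by
  rcases lt_trichotomy u v with h | rfl | h
  · exact Δ.boundaryCoeff_mul_of_lt h
  · rw [boundaryCoeff_mul_self, neg_zero]
  · rw [Δ.boundaryCoeff_mul_of_lt h, neg_neg]

/-- Swapping the order in which two vertices are inserted pairs off the terms with opposite signs.
-/
theorem boundary_boundary {b : ℕ} (g : Finset (Fin d) → Fin b → MvPolynomial (Fin Δ.numVars) k)
    (τ : Finset (Fin d)) : Δ.boundary (Δ.boundary g) τ = 0 := by
  simp only [boundary, Finset.smul_sum, smul_smul]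
  rw [← Finset.sum_product']
  refine Finset.sum_involution (fun x _ => x.swap) (fun x _ => ?_) (fun x _ hx h => hx ?_)
    (fun _ _ => by simp) (fun _ _ => rfl)
  · rw [Prod.fst_swap, Prod.snd_swap, boundaryCoeff_mul, Finset.insert_comm, neg_smul,
      neg_add_cancel]
  · have : x.2 = x.1 := congrArg Prod.fst h
    rw [this, boundaryCoeff_mul_self, zero_smul]

/-- When `e` is free of vertex variables, `x_v` is the only vertex variable dividing the monomial,
so only the summand of `v` contributes. -/
theorem coeff_boundary {b : ℕ} {g : Finset (Fin d) → Fin b → MvPolynomial (Fin Δ.numVars) k}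
    {τ : Finset (Fin d)} {r : Fin b} {v : Fin d} (hv : v ∉ τ)
    {e : Fin Δ.numVars →₀ ℕ} (he : ∀ u, e (Δ.vertexVar u) = 0) :
    coeff (Finsupp.single (Δ.vertexVar v) 1 + e) (Δ.boundary g τ r) =
      (-1) ^ (τ.filter fun u => u < v).card * coeff e (g (insert v τ) r) := by
  classical
  have hC : ∀ (a : ℕ) (h : MvPolynomial (Fin Δ.numVars) k) s,
      coeff s ((-1) ^ a * h) = (-1) ^ a * coeff s h := by
    intro a h s
    have : ((-1) ^ a : MvPolynomial (Fin Δ.numVars) k) = C ((-1) ^ a) := by simp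
    rw [this, coeff_C_mul]
  rw [boundary, Finset.sum_apply, coeff_sum, Finset.sum_eq_single v]
  · rw [Pi.smul_apply, boundaryCoeff, if_neg hv, smul_eq_mul, mul_assoc, hC, coeff_X_mul]
  · intro u _ hu
    rw [Pi.smul_apply, boundaryCoeff, smul_eq_mul]
    split_ifs
    · simp
    · rw [mul_assoc, hC, coeff_X_mul', if_neg, mul_zero]
      rw [Finsupp.notMem_support_iff, Finsupp.add_apply, he,
        Finsupp.single_eq_of_ne fun h => hu (Δ.vertexVar_injective h), add_zero]
  · simp

theorem isWeightedHomogeneous_boundary {b : ℕ}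
    {g : Finset (Fin d) → Fin b → MvPolynomial (Fin Δ.numVars) k} {τ : Finset (Fin d)}
    {a : Fin (d + 1) → ℤ} {r : Fin b} (h : ∀ v, v ∉ τ →
      IsWeightedHomogeneous Δ.config (g (insert v τ) r) (faceVec (insert v τ) - a)) :
    IsWeightedHomogeneous Δ.config (Δ.boundary g τ r) (faceVec τ - a) := by
  rw [boundary, Finset.sum_apply]
  refine IsWeightedHomogeneous.sum _ _ _ fun v _ => ?_
  rw [Pi.smul_apply, boundaryCoeff, smul_eq_mul]
  split_ifs with hv
  · rw [zero_mul]
    exact isWeightedHomogeneous_zero _ _ _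
  · have h1 : ((-1) ^ (τ.filter fun u => u < v).card : MvPolynomial (Fin Δ.numVars) k) =
        C ((-1) ^ (τ.filter fun u => u < v).card) := by simp
    have h2 := ((isWeightedHomogeneous_C Δ.config
      ((-1) ^ (τ.filter fun u => u < v).card : k)).mul
        (isWeightedHomogeneous_X k Δ.config (Δ.vertexVar v))).mul (h v hv)
    rw [h1]
    convert h2 using 1
    rw [← faceVec_insert_add hv, config_vertexVar]
    abel

end OrientedPseudomanifold

/-! ### Lifting families of faces along the resolution -/

namespace OrientedPseudomanifold

variable {n d : ℕ} (Δ : OrientedPseudomanifold n d) {k : Type*} [Field k]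

/-- A family of nonzero vectors `g τ ∈ F_i` of degree `faceVec τ`, indexed by the faces `τ` with
`n + 1 - i` elements, which do not involve the variables of the vertices, and whose boundary lies
in the image of `F_{i+1}`. -/
structure IsFaceFamily (F : MinimalFreeResolution Δ.config (toricIdeal k Δ.config)) (i : ℕ)
    (g : Finset (Fin d) → Fin (F.rk i) → MvPolynomial (Fin Δ.numVars) k) : Prop where
  homogeneous : ∀ τ, τ.card + i = n + 1 → ∀ r,
    IsWeightedHomogeneous Δ.config (g τ r) (faceVec τ - F.mdeg i r)
  vertex_free : ∀ τ, τ.card + i = n + 1 → ∀ r e, coeff e (g τ r) ≠ 0 →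
    ∀ v, e (Δ.vertexVar v) = 0
  ne_zero : ∀ τ, τ.card + i = n + 1 → ∀ σ ∈ Δ.facets, τ ⊆ σ → g τ ≠ 0
  mem_range : ∀ τ, τ.card + i = n → ∃ w, (F.diff i).mulVec w = Δ.boundary g τ

variable {Δ}

theorem card_insert_add {τ : Finset (Fin d)} {i : ℕ} (hτ : τ.card + i = n) {v : Fin d}
    (hv : v ∉ τ) : (insert v τ).card + i = n + 1 := by
  rw [Finset.card_insert_of_notMem hv]
  omega

/-- For `v ∈ σ` outside `τ`, the set `insert v τ` is still a face, and the monomials of its summand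
survive by `coeff_boundary`. -/
theorem IsFaceFamily.boundary_ne_zero
    {F : MinimalFreeResolution Δ.config (toricIdeal k Δ.config)} {i : ℕ}
    {g : Finset (Fin d) → Fin (F.rk i) → MvPolynomial (Fin Δ.numVars) k}
    (hg : Δ.IsFaceFamily F i g) {τ : Finset (Fin d)} (hτ : τ.card + i = n)
    {σ : Finset (Fin d)} (hσ : σ ∈ Δ.facets) (hτσ : τ ⊆ σ) : Δ.boundary g τ ≠ 0 := by
  obtain ⟨v, hvσ, hv⟩ : ∃ v ∈ σ, v ∉ τ :=
    Finset.exists_mem_notMem_of_card_lt_card (by rw [Δ.card_facet σ hσ]; omega)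
  have hins := card_insert_add hτ hv
  obtain ⟨r, hr⟩ := Function.ne_iff.1
    (hg.ne_zero _ hins σ hσ (Finset.insert_subset hvσ hτσ))
  obtain ⟨e, he⟩ := MvPolynomial.ne_zero_iff.1 hr
  intro h
  have h1 := Δ.coeff_boundary (g := g) (r := r) hv (hg.vertex_free _ hins r e he)
  rw [h, Pi.zero_apply, coeff_zero] at h1
  exact mul_ne_zero (pow_ne_zero _ (neg_ne_zero.2 one_ne_zero)) he h1.symm

theorem forall_eq_zero_of_isHomogeneous_one :
    ∀ g ∈ toricIdeal k Δ.config, g.IsHomogeneous 1 → g = 0 := fun _ hg h1 =>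
  eq_zero_of_mem_toricIdeal_of_isHomogeneous_one Δ.config_injective hg h1

/-- The height of `faceVec τ` is `i + 2`, the lower bound for degrees of generators of `F_{i+1}`, so
no variables can occur. -/
theorem eq_C_of_isWeightedHomogeneous_faceVec
    (F : MinimalFreeResolution Δ.config (toricIdeal k Δ.config)) {i : ℕ} {τ : Finset (Fin d)}
    (hτ : τ.card + (i + 1) = n + 1) {r : Fin (F.rk (i + 1))} {g : MvPolynomial (Fin Δ.numVars) k}
    (hg : IsWeightedHomogeneous Δ.config g (faceVec τ - F.mdeg (i + 1) r)) :
    g = C (constantCoeff g) := by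
  refine eq_C_of_isWeightedHomogeneous_nonpos ?_ (isWeightedHomogeneous_map Δ.height_config hg)
  have := F.le_degree_mdeg Δ.height_config forall_eq_zero_of_isHomogeneous_one i r
  rw [map_sub, height_faceVec]
  omega

theorem IsFaceFamily.exists_succ
    {F : MinimalFreeResolution Δ.config (toricIdeal k Δ.config)} {i : ℕ}
    {g : Finset (Fin d) → Fin (F.rk i) → MvPolynomial (Fin Δ.numVars) k}
    (hg : Δ.IsFaceFamily F i g) : ∃ g', Δ.IsFaceFamily F (i + 1) g' ∧
      ∀ τ, τ.card + i = n → (F.diff i).mulVec (g' τ) = Δ.boundary g τ := by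
  have h : ∀ τ, ∃ w, τ.card + i = n → (F.diff i).mulVec w = Δ.boundary g τ := by
    intro τ
    by_cases hτ : τ.card + i = n
    · obtain ⟨w, hw⟩ := hg.mem_range τ hτ
      exact ⟨w, fun _ => hw⟩
    · exact ⟨0, fun h => absurd h hτ⟩
  choose w hw using h
  -- An arbitrary preimage need not be homogeneous; its part of degree `faceVec τ` has the same
  -- image, since the boundary already has that degree.
  let g' : Finset (Fin d) → Fin (F.rk (i + 1)) → MvPolynomial (Fin Δ.numVars) k := fun τ =>
    MinimalFreeResolution.vecPart Δ.config (F.mdeg (i + 1)) (faceVec τ) (w τ)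
  have hhom : ∀ τ r, IsWeightedHomogeneous Δ.config (g' τ r) (faceVec τ - F.mdeg (i + 1) r) :=
    fun τ r => weightedHomogeneousComponent_isWeightedHomogeneous _ _
  have hdiff : ∀ τ, τ.card + i = n → (F.diff i).mulVec (g' τ) = Δ.boundary g τ := by
    intro τ hτ
    rw [MinimalFreeResolution.mulVec_vecPart (F.homogeneous i), hw τ hτ]
    funext r
    exact (Δ.isWeightedHomogeneous_boundary fun v hv => hg.homogeneous _ (card_insert_add hτ hv)
      r).weightedHomogeneousComponent_same
  refine ⟨g', ⟨fun τ _ => hhom τ, fun τ hτ r e he v => ?_, fun τ hτ σ hσ hτσ h0 => ?_,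
    fun τ hτ => ?_⟩, hdiff⟩
  · rw [eq_C_of_isWeightedHomogeneous_faceVec F hτ (hhom τ r), coeff_C] at he
    rw [← (ite_ne_right_iff.1 he).1, Finsupp.zero_apply]
  · refine hg.boundary_ne_zero (by omega) hσ hτσ ?_
    rw [← hdiff τ (by omega), h0, Matrix.mulVec_zero]
  · obtain ⟨w', hw'⟩ := (F.exact i (Δ.boundary g' τ)).1 (by
      -- The boundary commutes with the differential, so the boundary of the lift is a cycle. Terms
      -- with `v ∈ τ` have coefficient zero, which matters as `hdiff` does not cover them.
      have h : (F.diff i).mulVec (Δ.boundary g' τ) = Δ.boundary (Δ.boundary g) τ := by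
        rw [boundary, Matrix.mulVec_sum, boundary]
        refine Finset.sum_congr rfl fun v _ => ?_
        rw [Matrix.mulVec_smul]
        by_cases hv : v ∈ τ
        · simp [boundaryCoeff, hv]
        · rw [hdiff _ (by have := card_insert_add hτ hv; omega)]
      rw [h, boundary_boundary])
    exact ⟨w', hw'⟩

/-- The variable of a facet with the sign of the facet, and zero for the other sets. -/
noncomputable def signedVar (Δ : OrientedPseudomanifold n d) (k : Type*) [Field k]
    (σ : Finset (Fin d)) : MvPolynomial (Fin Δ.numVars) k :=
  if h : σ ∈ Δ.facets then C ((Δ.sign σ : ℤ) : k) * X (Δ.facetVar ⟨σ, h⟩) else 0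

theorem toricMap_signedVar (σ : Finset (Fin d)) : toricMap k Δ.config (Δ.signedVar k σ) =
    AddMonoidAlgebra.single (faceVec σ) (if σ ∈ Δ.facets then ((Δ.sign σ : ℤ) : k) else 0) := by
  by_cases h : σ ∈ Δ.facets
  · rw [signedVar, dif_pos h, if_pos h, C_mul_X_eq_monomial, toricMap_monomial,
      Finset.sum_eq_single (Δ.facetVar ⟨σ, h⟩)] <;> simp +contextual
  · simp [signedVar, h]

/-- All terms map to multiples of one basis element, of degree `faceVec τ`, and the sum of their
coefficients is the one in `Δ.cancel`. -/
theorem boundary_signedVar_mem {b : ℕ} {τ : Finset (Fin d)} (hτ : τ.card = n) (r : Fin b) :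
    Δ.boundary (fun σ _ => Δ.signedVar k σ) τ r ∈ toricIdeal k Δ.config := by
  rw [toricIdeal_eq_ker, RingHom.mem_ker, boundary, Finset.sum_apply, map_sum]
  have h : ∀ v, toricMap k Δ.config (Δ.boundaryCoeff k τ v * Δ.signedVar k (insert v τ)) =
      AddMonoidAlgebra.single (faceVec τ) ((if v ∉ τ ∧ insert v τ ∈ Δ.facets then
        ((Δ.sign (insert v τ) : ℤˣ) : ℤ) * (-1) ^ (τ.filter fun u => u < v).card else 0 : ℤ) : k) := by
    intro v
    rw [map_mul, toricMap_signedVar, boundaryCoeff]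
    by_cases hv : v ∈ τ
    · simp [hv]
    · have h1 : ((-1) ^ (τ.filter fun u => u < v).card : AddMonoidAlgebra k (Fin (d + 1) → ℤ)) =
          AddMonoidAlgebra.single 0 ((-1) ^ (τ.filter fun u => u < v).card) := by
        rw [← map_one (algebraMap k (AddMonoidAlgebra k (Fin (d + 1) → ℤ))), ← map_neg, ← map_pow]
        rfl
      rw [if_neg hv, map_mul, map_pow, map_neg, map_one, toricMap_X, config_vertexVar, h1,
        AddMonoidAlgebra.single_mul_single, AddMonoidAlgebra.single_mul_single, zero_add,
        add_comm (vertexVec v), faceVec_insert_add hv]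
      congr 1
      by_cases h : insert v τ ∈ Δ.facets <;> simp [hv, h, mul_comm]
  refine (Finset.sum_congr rfl fun v _ => h v).trans ?_
  have hc := Δ.cancel τ hτ
  rw [Finset.sum_filter] at hc
  have := congrArg (fun z : ℤ => AddMonoidAlgebra.single (faceVec τ) (z : k)) hc
  simp only [Int.cast_sum, Int.cast_zero, AddMonoidAlgebra.single_zero] at this
  rw [← this]
  exact (map_sum (AddMonoidAlgebra.singleAddHom (faceVec τ)) _ _).symm

theorem isFaceFamily_signedVar (F : MinimalFreeResolution Δ.config (toricIdeal k Δ.config)) :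
    Δ.IsFaceFamily F 0 fun σ _ => Δ.signedVar k σ := by
  refine ⟨fun τ hτ r => ?_, fun τ hτ r e he v => ?_, fun τ hτ σ hσ hτσ h0 => ?_, fun τ hτ => ?_⟩
  · rw [F.mdeg_zero, sub_zero, signedVar]
    split_ifs with h
    · simpa using (isWeightedHomogeneous_C Δ.config ((Δ.sign τ : ℤ) : k)).mul
        (isWeightedHomogeneous_X k Δ.config (Δ.facetVar ⟨τ, h⟩))
    · exact isWeightedHomogeneous_zero _ _ _
  · classical
    rw [signedVar] at he
    split_ifs at he with h
    · rw [coeff_C_mul, coeff_X] at he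
      obtain ⟨he, -⟩ := ite_ne_right_iff.1 (right_ne_zero_of_mul he)
      rw [← he, Finsupp.single_eq_of_ne]
      exact fun h => Δ.facetVar_ne_vertexVar _ v h.symm
    · exact absurd (coeff_zero _) he
  -- At level `0` the sets have `n + 1` elements, so a face is a facet.
  · have h : τ = σ := Finset.eq_of_subset_of_card_le hτσ (by rw [Δ.card_facet σ hσ]; omega)
    subst h
    have h1 := congrFun h0 (Fin.cast F.rk_zero.symm 0)
    rw [signedVar, dif_pos hσ, Pi.zero_apply] at h1
    refine mul_ne_zero ?_ (X_ne_zero _) h1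
    rw [C_ne_zero]
    rcases Int.units_eq_one_or (Δ.sign τ) with h | h <;> simp [h]
  · obtain ⟨w, hw⟩ := (F.mem_iff (Fin.cast F.rk_zero.symm 0) _).1
      (boundary_signedVar_mem (k := k) hτ (Fin.cast F.rk_zero.symm 0))
    refine ⟨w, funext fun r => ?_⟩
    have hr : r = Fin.cast F.rk_zero.symm 0 := by
      apply Fin.ext
      have := r.2
      have := F.rk_zero
      simp
      omega
    rw [hr, hw]

theorem exists_isFaceFamily (F : MinimalFreeResolution Δ.config (toricIdeal k Δ.config)) (i : ℕ) :
    ∃ g, Δ.IsFaceFamily F i g := by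
  induction i with
  | zero => exact ⟨_, isFaceFamily_signedVar F⟩
  | succ i ih =>
    obtain ⟨g, hg⟩ := ih
    obtain ⟨g', hg', -⟩ := hg.exists_succ
    exact ⟨g', hg'⟩

end OrientedPseudomanifold

/-! ### The rank of the syzygy -/

namespace OrientedPseudomanifold

variable {n d : ℕ} {Δ : OrientedPseudomanifold n d} {k : Type*} [Field k]

theorem card_singleton_add : ∀ v : Fin d, ({v} : Finset (Fin d)).card + n = n + 1 := fun v => by
  rw [Finset.card_singleton, add_comm]

theorem boundary_empty {b : ℕ} (g : Finset (Fin d) → Fin b → MvPolynomial (Fin Δ.numVars) k) :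
    Δ.boundary g ∅ = ∑ v, (X (Δ.vertexVar v) : MvPolynomial (Fin Δ.numVars) k) • g {v} := by
  simp [boundary, boundaryCoeff]

variable {F : MinimalFreeResolution Δ.config (toricIdeal k Δ.config)}

theorem IsFaceFamily.mem_component {g : Finset (Fin d) → Fin (F.rk n) →
    MvPolynomial (Fin Δ.numVars) k} (hg : Δ.IsFaceFamily F n g) (v : Fin d) :
    g {v} ∈ F.component (height n d) n ((n : ℤ) + 1) := by
  intro r _
  have := isWeightedHomogeneous_map Δ.height_config (hg.homogeneous _ (card_singleton_add v) r)
  rw [map_sub, height_faceVec, Finset.card_singleton] at this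
  change IsWeightedHomogeneous _ _ _
  convert this using 1
  push_cast
  ring

theorem IsFaceFamily.singleton_ne_zero {g : Finset (Fin d) → Fin (F.rk n) →
    MvPolynomial (Fin Δ.numVars) k} (hg : Δ.IsFaceFamily F n g) (v : Fin d) : g {v} ≠ 0 := by
  obtain ⟨σ, hσ, hv⟩ := Δ.exists_facet v
  exact hg.ne_zero _ (card_singleton_add v) σ hσ (Finset.singleton_subset_iff.2 hv)

end OrientedPseudomanifold

namespace MinimalFreeResolution

variable {k : Type*} [Field k] {p q : ℕ} {A : Fin q → Fin p → ℤ}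
  {I : Ideal (MvPolynomial (Fin q) k)} (F : MinimalFreeResolution A I)

/-- The component is in the lowest degree possible for `F_{i+1}`. -/
theorem eq_C_of_mem_component {ℓ : (Fin p → ℤ) →+ ℤ} (hℓ : ∀ j, ℓ (A j) = 1)
    (hI : ∀ g ∈ I, g.IsHomogeneous 1 → g = 0) {i : ℕ}
    {h : Fin (F.rk (i + 1)) → MvPolynomial (Fin q) k}
    (hh : h ∈ F.component ℓ (i + 1) ((i + 1 : ℕ) + 1)) (r : Fin (F.rk (i + 1))) :
    h r = C (constantCoeff (h r)) := by
  refine eq_C_of_isWeightedHomogeneous_nonpos ?_ (hh r trivial)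
  have := F.le_degree_mdeg hℓ hI i r
  push_cast
  omega

end MinimalFreeResolution

/-- The vector of the coefficients of the variable `X j`, as constant polynomials. -/
noncomputable def linearCoeff (k : Type*) [Field k] {q : ℕ} (b : ℕ) (j : Fin q) :
    (Fin b → MvPolynomial (Fin q) k) →ₗ[k] (Fin b → MvPolynomial (Fin q) k) :=
  LinearMap.pi fun r => (Algebra.linearMap k (MvPolynomial (Fin q) k)).comp
    ((lcoeff k (Finsupp.single j 1)).comp (LinearMap.proj r))

theorem linearCoeff_X_smul {k : Type*} [Field k] {q b : ℕ} (i j : Fin q)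
    {h : Fin b → MvPolynomial (Fin q) k} (hh : ∀ r, h r = C (constantCoeff (h r))) :
    linearCoeff k b j ((X i : MvPolynomial (Fin q) k) • h) = if i = j then h else 0 := by
  classical
  funext r
  have : linearCoeff k b j ((X i : MvPolynomial (Fin q) k) • h) r =
      C (coeff (Finsupp.single j 1) (X i * h r)) := rfl
  rw [this, hh r, mul_comm, coeff_C_mul, coeff_X]
  by_cases hij : i = j
  · subst hij
    simp [← hh r]
  · rw [if_neg hij, if_neg]
    · simp
    · simpa [Finsupp.single_left_inj] using hij

namespace OrientedPseudomanifold

variable {n d : ℕ} {Δ : OrientedPseudomanifold n d} {k : Type*} [Field k]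

theorem IsFaceFamily.le_finrank_of_pos {i : ℕ} {Δ : OrientedPseudomanifold (i + 1) d}
    {F : MinimalFreeResolution Δ.config (toricIdeal k Δ.config)}
    {g : Finset (Fin d) → Fin (F.rk (i + 1)) → MvPolynomial (Fin Δ.numVars) k}
    (hg : Δ.IsFaceFamily F (i + 1) g)
    {G : Submodule k (Fin (F.rk (i + 1)) → MvPolynomial (Fin Δ.numVars) k)}
    (hG : G ≤ F.component (height (i + 1) d) (i + 1) ((i + 1 : ℕ) + 1)) [Module.Finite k G]
    (hmem : Δ.boundary g ∅ ∈ Submodule.span k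
      {v | ∃ j : Fin Δ.numVars, ∃ h ∈ G, v = (X j : MvPolynomial (Fin Δ.numVars) k) • h}) :
    d ≤ Module.finrank k G := by
  have hconst : ∀ h ∈ F.component (height (i + 1) d) (i + 1) ((i + 1 : ℕ) + 1), ∀ r,
      h r = C (constantCoeff (h r)) := fun h hh r =>
    F.eq_C_of_mem_component Δ.height_config forall_eq_zero_of_isHomogeneous_one hh r
  have hgG : ∀ v, g {v} ∈ G := by
    intro v
    -- Elements of `G` are constant vectors, so extracting the coefficient of `x_v` sends `S_1 · G`
    -- back into `G`.
    have h1 : Submodule.span k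
        {v | ∃ j : Fin Δ.numVars, ∃ h ∈ G, v = (X j : MvPolynomial (Fin Δ.numVars) k) • h} ≤
          G.comap (linearCoeff k _ (Δ.vertexVar v)) := by
      refine Submodule.span_le.2 ?_
      rintro _ ⟨j, h, hh, rfl⟩
      change linearCoeff k _ _ _ ∈ G
      rw [linearCoeff_X_smul _ _ (hconst h (hG hh))]
      split_ifs
      · exact hh
      · exact zero_mem _
    have h2 : linearCoeff k _ (Δ.vertexVar v) (Δ.boundary g ∅) ∈ G := h1 hmem
    rw [boundary_empty, map_sum, Finset.sum_eq_single v] at h2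
    · rwa [linearCoeff_X_smul _ _ (hconst _ (hg.mem_component v)), if_pos rfl] at h2
    · intro u _ hu
      rw [linearCoeff_X_smul _ _ (hconst _ (hg.mem_component u)),
        if_neg fun h => hu (Δ.vertexVar_injective h)]
    · simp
  -- A nonzero constant entry pins down the degree of its basis element; hence the `g {v}` have
  -- disjoint supports and are independent.
  have hmdeg : ∀ v r, g {v} r ≠ 0 → F.mdeg (i + 1) r = faceVec {v} := by
    intro v r hr
    have h1 := hg.homogeneous _ (card_singleton_add v) r
    have h2 := hconst _ (hg.mem_component v) r
    have h3 : coeff 0 (g {v} r) ≠ 0 := by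
      intro h0
      rw [← constantCoeff_eq] at h0
      rw [h0, C_0] at h2
      exact hr h2
    have := h1 h3
    rw [map_zero] at this
    exact (sub_eq_zero.1 this.symm).symm
  have hind : LinearIndependent k fun v => g {v} := by
    rw [Fintype.linearIndependent_iff]
    intro c hc v
    obtain ⟨r, hr⟩ := Function.ne_iff.1 (hg.singleton_ne_zero v)
    have h := congrFun hc r
    rw [Finset.sum_apply, Finset.sum_eq_single v] at h
    · exact (smul_eq_zero.1 h).resolve_right hr
    · intro u _ hu
      rw [Pi.smul_apply]
      by_contra h0
      have hur : g {u} r ≠ 0 := fun h => h0 (by rw [h, smul_zero])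
      exact hu (Finset.singleton_injective
        (faceVec_injective ((hmdeg u r hur).symm.trans (hmdeg v r hr))))
    · simp
  have h1 := finrank_span_eq_card hind
  rw [Fintype.card_fin] at h1
  refine h1.symm.le.trans (Submodule.finrank_mono (Submodule.span_le.2 ?_))
  rintro _ ⟨v, rfl⟩
  exact hgG v

/-- The empty set is the only `0`-subset, and it lies in every facet; so there are at most two
facets, all of them singletons. -/
theorem le_two (Δ : OrientedPseudomanifold 0 d) : d ≤ 2 := by
  have h : ∀ v : Fin d, {v} ∈ Δ.facets := by
    intro v
    obtain ⟨σ, hσ, hv⟩ := Δ.exists_facet v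
    obtain ⟨u, rfl⟩ := Finset.card_eq_one.1 (Δ.card_facet σ hσ)
    rwa [Finset.mem_singleton.1 hv]
  have h1 : (Finset.univ : Finset (Fin d)).card ≤ Δ.facets.card :=
    Finset.card_le_card_of_injOn (fun v => {v}) (fun v _ => h v)
      Finset.singleton_injective.injOn
  have h2 := Δ.zero_or_two ∅ Finset.card_empty
  simp only [Finset.empty_subset, Finset.filter_true, Finset.card_univ, Fintype.card_fin] at h1 h2
  omega

/-- In `F_0 = S` the component consists of linear forms, not constants, so the coefficient argument
is replaced by primality. -/
theorem IsFaceFamily.le_finrank_of_eq_zero {Δ : OrientedPseudomanifold 0 d}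
    {F : MinimalFreeResolution Δ.config (toricIdeal k Δ.config)}
    {g : Finset (Fin d) → Fin (F.rk 0) → MvPolynomial (Fin Δ.numVars) k}
    (hg : Δ.IsFaceFamily F 0 g)
    {G : Submodule k (Fin (F.rk 0) → MvPolynomial (Fin Δ.numVars) k)}
    (hG : G ≤ F.component (height 0 d) 0 ((0 : ℕ) + 1)) [Module.Finite k G]
    (hmem : Δ.boundary g ∅ ∈ Submodule.span k
      {v | ∃ j : Fin Δ.numVars, ∃ h ∈ G, v = (X j : MvPolynomial (Fin Δ.numVars) k) • h}) :
    d ≤ Module.finrank k G := by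
  refine Δ.le_two.trans (not_lt.1 fun hlt => ?_)
  -- If `G` is spanned by a single `h`, every element of `S_1 · G` is a linear form times `h`.
  obtain ⟨h, hh⟩ := finrank_le_one_iff.1 (Nat.lt_succ_iff.1 hlt)
  have hspan : ∀ x ∈ Submodule.span k
      {v | ∃ j : Fin Δ.numVars, ∃ h ∈ G, v = (X j : MvPolynomial (Fin Δ.numVars) k) • h},
      ∃ L : MvPolynomial (Fin Δ.numVars) k, L.IsHomogeneous 1 ∧ x = L • h.1 := by
    intro x hx
    induction hx using Submodule.span_induction with
    | mem x hx =>
      obtain ⟨j, y, hy, rfl⟩ := hx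
      obtain ⟨c, hc⟩ := hh ⟨y, hy⟩
      refine ⟨C c * X j, by simpa using (isHomogeneous_C _ c).mul (isHomogeneous_X k j), ?_⟩
      have hc : c • h.1 = y := congrArg Subtype.val hc
      rw [← hc, ← smul_eq_C_mul, smul_assoc, smul_comm]
    | zero => exact ⟨0, isHomogeneous_zero _ _ _, by simp⟩
    | add x y _ _ hx hy =>
      obtain ⟨L, hL, rfl⟩ := hx
      obtain ⟨M, hM, rfl⟩ := hy
      exact ⟨L + M, hL.add hM, (add_smul _ _ _).symm⟩
    | smul c x _ hx =>
      obtain ⟨L, hL, rfl⟩ := hx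
      exact ⟨c • L, (homogeneousSubmodule _ k 1).smul_mem c hL, (smul_assoc _ _ _).symm⟩
  obtain ⟨L, hL, hLh⟩ := hspan _ hmem
  obtain ⟨⟨σ, hσ⟩⟩ := Δ.nonempty_facets
  obtain ⟨r, hr⟩ := Function.ne_iff.1
    (hg.boundary_ne_zero (by simp) hσ (Finset.empty_subset σ))
  obtain ⟨w, hw⟩ := hg.mem_range ∅ (by simp)
  have hI : Δ.boundary g ∅ r ∈ toricIdeal k Δ.config := (F.mem_iff r _).2 ⟨w, by rw [hw]⟩
  have hhr : (h.1 r).IsHomogeneous 1 := by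
    intro e he
    have := hG h.2 r trivial he
    rw [weight_one_eq_degree, F.mdeg_zero, map_zero] at this
    change Finsupp.weight (fun _ => 1) e = 1
    rw [← Finsupp.degree_eq_weight_one]
    change e.degree = 1
    push_cast at this
    omega
  rw [hLh] at hI hr
  -- One of the two linear factors lies in the ideal, hence vanishes, although the product is
  -- nonzero.
  rcases (toricIdeal_isPrime (k := k) Δ.config).mem_or_mem hI with h0 | h0
  · rw [forall_eq_zero_of_isHomogeneous_one _ h0 hL] at hr
    simp at hr
  · have := forall_eq_zero_of_isHomogeneous_one _ h0 hhr
    simp [this] at hr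

theorem IsFaceFamily.le_finrank {F : MinimalFreeResolution Δ.config (toricIdeal k Δ.config)}
    {g : Finset (Fin d) → Fin (F.rk n) → MvPolynomial (Fin Δ.numVars) k}
    (hg : Δ.IsFaceFamily F n g)
    {G : Submodule k (Fin (F.rk n) → MvPolynomial (Fin Δ.numVars) k)}
    (hG : G ≤ F.component (height n d) n ((n : ℤ) + 1)) [Module.Finite k G]
    (hmem : Δ.boundary g ∅ ∈ Submodule.span k
      {v | ∃ j : Fin Δ.numVars, ∃ h ∈ G, v = (X j : MvPolynomial (Fin Δ.numVars) k) • h}) :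
    d ≤ Module.finrank k G := by
  cases n with
  | zero => exact hg.le_finrank_of_eq_zero hG hmem
  | succ i => exact hg.le_finrank_of_pos hG hmem

theorem exists_minimalLinearSyzygy
    (F : MinimalFreeResolution Δ.config (toricIdeal k Δ.config)) :
    ∃ f, F.IsMinimalLinearSyzygy (height n d) n (faceVec ∅) f ∧
      F.HasSyzygyRank (height n d) n f d := by
  obtain ⟨g, hg⟩ := exists_isFaceFamily F n
  obtain ⟨g', hg', hdiff⟩ := hg.exists_succ
  have hempty : (∅ : Finset (Fin d)).card + (n + 1) = n + 1 := by simp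
  have hd := hdiff ∅ (by simp)
  refine ⟨g' ∅, ⟨hg'.homogeneous ∅ hempty, by simp [height_faceVec], ?_⟩, ?_, ?_⟩
  · obtain ⟨⟨σ, hσ⟩⟩ := Δ.nonempty_facets
    obtain ⟨r, hr⟩ := Function.ne_iff.1 (hg'.ne_zero ∅ hempty σ hσ (Finset.empty_subset σ))
    refine ⟨r, fun h0 => hr ?_⟩
    rw [eq_C_of_isWeightedHomogeneous_faceVec F hempty (hg'.homogeneous ∅ hempty r), h0, C_0,
      Pi.zero_apply]
  · have hle : Submodule.span k (Set.range fun v => g {v}) ≤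
        F.component (height n d) n ((n : ℤ) + 1) := by
      refine Submodule.span_le.2 ?_
      rintro _ ⟨v, rfl⟩
      exact hg.mem_component v
    have hmem : Δ.boundary g ∅ ∈ Submodule.span k {x | ∃ j : Fin Δ.numVars,
        ∃ h ∈ Submodule.span k (Set.range fun v => g {v}),
          x = (X j : MvPolynomial (Fin Δ.numVars) k) • h} := by
      rw [boundary_empty]
      exact sum_mem fun v _ => Submodule.subset_span
        ⟨_, _, Submodule.subset_span ⟨v, rfl⟩, rfl⟩
    have : Module.Finite k (Submodule.span k (Set.range fun v => g {v})) :=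
      Module.Finite.span_of_finite k (Set.finite_range _)
    -- The lower bound, applied to the span of the `g {v}` itself, shows that its dimension is
    -- exactly `d`.
    refine ⟨_, hle, this, le_antisymm ?_ (hg.le_finrank hle hmem), by rwa [hd]⟩
    exact (finrank_range_le_card (R := k) fun v => g {v}).trans (Fintype.card_fin d).le
  · rintro t ⟨G, hG, hfin, rfl, hmem⟩
    rw [hd] at hmem
    exact hg.le_finrank hG hmem

end OrientedPseudomanifold

theorem theorem1p8 {k : Type*} [Field k] [IsAlgClosed k] [CharZero k] (n d : ℕ)
    (Δ : OrientedPseudomanifold n d) :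
    ∃ (p q : ℕ) (A : Fin q → Fin p → ℤ) (ℓ : (Fin p → ℤ) →+ ℤ) (m : Fin p → ℤ),
      -- the toric ideal is prime, homogeneous for the standard grading and has no linear form
      (∀ j, ℓ (A j) = 1) ∧
      (toricIdeal k A).IsPrime ∧
      (∀ g ∈ toricIdeal k A, g.IsHomogeneous 1 → g = 0) ∧
      -- its variety in projective space has dimension `d`
      ringKrullDim (MvPolynomial (Fin q) k ⧸ toricIdeal k A) = ((d + 1 : ℕ) : WithBot ℕ∞) ∧
      -- there is a minimal linear `n`-th syzygy of multidegree `m` and rank `d`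
      Nonempty (MinimalFreeResolution A (toricIdeal k A)) ∧
      (∀ F : MinimalFreeResolution A (toricIdeal k A),
        ∃ f, F.IsMinimalLinearSyzygy ℓ n m f ∧ F.HasSyzygyRank ℓ n f d) ∧
      -- the simplicial complex `Δ_m` is homotopy equivalent to `Δ`
      Nonempty ((degreeComplex A m).realization ≃ₕ Δ.complex.realization) :=
  ⟨d + 1, Δ.numVars, Δ.config, OrientedPseudomanifold.height n d,
    OrientedPseudomanifold.faceVec ∅, Δ.height_config, toricIdeal_isPrime _,
    OrientedPseudomanifold.forall_eq_zero_of_isHomogeneous_one, Δ.ringKrullDim_config k,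
    MinimalFreeResolution.nonempty_toricIdeal Δ.height_config,
    OrientedPseudomanifold.exists_minimalLinearSyzygy, Δ.nonempty_homotopyEquiv⟩
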